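/- For every integer $p\ge 2$ there are constants $c_2(p),c_3(p)>0$ depending only on $p$ such that the following holds. Let $\mathfrak H,\mathfrak H_*$ be complex separable Hilbert spaces and let $X(t)=\sum_{j=0}^{p}X_jt^j$, $t\in\mathbb R$, where $X_j$ are linear operators from $\mathfrak H$ to $\mathfrak H_*$, $X_0$ is densely defined and closed, and $X_p$ is bounded and defined on all of $\mathfrak H$. Assume: 1. $\operatorname{Dom}X(t)=\operatorname{Dom}X_0\subset\operatorname{Dom}X_j\subset\operatorname{Dom}X_p=\mathfrak H$ for $j=0,\dots,p$ and $t\in\mathbb R$; 2. $\|X_ju\|\le C_0\|X_0u\|$ for $j=0,\dots,p-1$ and $u\in\operatorname{Dom}X_0$, with a constant $C_0\ge1$; 3. $0$ is an isolated point of the spectrum of $A_0=X_0^*X_0$, and for $\mathfrak N=\operatorname{Ker}X_0$, $\mathfrak N_*=\operatorname{Ker}X_0^*$ one has $\dim\mathfrak N<\infty$ and $\dim\mathfrak N\le\dim\mathfrak N_*\le\infty$. Let $d^0$ be the distance from $0$ to $\sigma(A_0)\setminus\{0\}$ ($d^0=\infty$ if this set is empty), let $0<\delta\le\min\{d^0/36,1/4\}$,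 $C_1=\max\{(p-1)C_0,\|X_p\|\}$ and $0<t_0\le\delta^{1/2}C_1^{-1}$. Let $A(t)=X(t)^*X(t)$ for $|t|\le t_0$, let $P$ and $P_*$ be the orthogonal projections onto $\mathfrak N$ and $\mathfrak N_*$, let $R=P_*X_p|_{\mathfrak N}:\mathfrak N\to\mathfrak N_*$ and $S=R^*R:\mathfrak N\to\mathfrak N$. Put $$C_T=pC_0^2+\|X_p\|^2\delta^{-1},\qquad C_2=c_2(p)\,C_T,\qquad C_3=c_3(p)\,C_T^{2p+1}.$$ Then, for $|t|\le t_0$, the strongly continuous one-parameter unitary group $e^{-i\tau A(t)}$, $\tau\in\mathbb R$, with generator $-iA(t)$ is well defined, and the operator $$J(t,\tau)=\bigl(e^{-i\tau A(t)}-e^{-i\tau t^{2p}SP}\bigr)P$$ satisfies, for all $\tau\in\mathbb R$, $\varepsilon>0$ and $|t|\le t_0$, $$\|J(t,\tau\varepsilon^{-2p})\|\,\frac{\varepsilon^{2p+1}}{(t^2+\varepsilon^2)^{p+1/2}}\le (C_2+C_3|\tau|)\,\varepsilon .$$ -/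

import Mathlib

open scoped LinearPMap InnerProductSpace

noncomputable section

namespace OperatorPencil

section Unbounded

variable {H K : Type*}
  [NormedAddCommGroup H] [InnerProductSpace ℂ H]
  [NormedAddCommGroup K] [InnerProductSpace ℂ K]

/-- The kernel of a partially defined operator, as a subspace of the ambient space. -/
def kernel (T : H →ₗ.[ℂ] K) : Submodule ℂ H :=
  (LinearMap.ker T.toFun).map T.domain.subtype

theorem mem_kernel_iff (T : H →ₗ.[ℂ] K) (x : H) :
    x ∈ kernel T ↔ (x, (0 : K)) ∈ T.graph := by
  simp only [kernel, Submodule.mem_map, LinearMap.mem_ker, LinearPMap.mem_graph_iff]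
  constructor
  · rintro ⟨y, hy, rfl⟩
    exact ⟨y, rfl, hy⟩
  · rintro ⟨y, hy, h0⟩
    exact ⟨y, h0, hy⟩

theorem isClosed_kernel {T : H →ₗ.[ℂ] K} (hT : T.IsClosed) :
    IsClosed (kernel T : Set H) := by
  have h : (kernel T : Set H) = (fun x : H => (x, (0 : K))) ⁻¹' (T.graph : Set (H × K)) := by
    ext x
    exact mem_kernel_iff T x
  rw [h]
  exact IsClosed.preimage (by fun_prop) hT

variable [CompleteSpace H]

/-- The operator `T* T` on its natural domain `{x ∈ Dom T | T x ∈ Dom T*}`. -/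
def adjointMulSelf (T : H →ₗ.[ℂ] K) : H →ₗ.[ℂ] H :=
  (T†).comp (T.domRestrict ((T†.domain.comap T.toFun).map T.domain.subtype)) (by
    rintro ⟨x, hx⟩
    obtain ⟨⟨y, hy, rfl⟩, hx2⟩ := hx
    exact hy)

/-- `z` is in the resolvent set of `T` if `T - z : Dom T → H` is a bijection with a bounded
inverse `B`. -/
def IsResolventPoint (T : H →ₗ.[ℂ] H) (z : ℂ) : Prop :=
  ∃ B : H →L[ℂ] H,
    (∀ x : T.domain, B (T x - z • (x : H)) = x) ∧
    (∀ y : H, ∃ x : T.domain, (x : H) = B y ∧ T x - z • (x : H) = y)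

/-- The spectrum of a partially defined operator. -/
def unboundedSpectrum (T : H →ₗ.[ℂ] H) : Set ℂ := {z | ¬ IsResolventPoint T z}

/-- `U` is the strongly continuous one-parameter unitary group with generator `-i T`,
where the domain of the generator is exactly the domain of `T`. -/
structure IsUnitaryGroup (T : H →ₗ.[ℂ] H) (U : ℝ → H →L[ℂ] H) : Prop where
  zero : U 0 = 1
  add : ∀ s r : ℝ, U (s + r) = U s * U r
  unitary : ∀ s : ℝ, U s ∈ unitary (H →L[ℂ] H)
  continuous : ∀ x : H, Continuous fun s : ℝ => U s x
  generator : ∀ x y : H,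
    (x, y) ∈ T.graph ↔ HasDerivAt (fun s : ℝ => U s x) (-(Complex.I • y)) 0

theorem IsUnitaryGroup.hasDerivAt {T : H →ₗ.[ℂ] H} {U : ℝ → H →L[ℂ] H}
    (hU : IsUnitaryGroup T U) {x y : H} (hxy : (x, y) ∈ T.graph) (s : ℝ) :
    HasDerivAt (fun r : ℝ => U r x) (-(Complex.I • U s y)) s := by
  have h0 := (hU.generator x y).1 hxy
  have h1 : HasDerivAt (fun r : ℝ => U (r - s) x) (-(Complex.I • y)) s := by
    have h := HasDerivAt.scomp_of_eq (g₁ := fun r : ℝ => U r x) (h := fun r : ℝ => r - s) s h0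
      ((hasDerivAt_id s).sub_const s) (by simp)
    simpa [Function.comp_def] using h
  have h2 := ((U s).restrictScalars ℝ).hasFDerivAt.comp_hasDerivAt s h1
  have h3 : (fun r : ℝ => U r x) = (fun r : ℝ => (U s).restrictScalars ℝ (U (r - s) x)) := by
    funext r
    have h4 := hU.add s (r - s)
    rw [add_sub_cancel] at h4
    rw [h4]
    rfl
  rw [h3]
  simpa [Function.comp_def] using h2

theorem IsUnitaryGroup.mem_graph {T : H →ₗ.[ℂ] H} {U : ℝ → H →L[ℂ] H}
    (hU : IsUnitaryGroup T U) {x y : H} (hxy : (x, y) ∈ T.graph) (s : ℝ) :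
    (U s x, U s y) ∈ T.graph := by
  rw [hU.generator]
  have h0 := (hU.generator x y).1 hxy
  have h2 := ((U s).restrictScalars ℝ).hasFDerivAt.comp_hasDerivAt (0 : ℝ) h0
  have h3 : (fun r : ℝ => U r (U s x)) = (fun r : ℝ => (U s).restrictScalars ℝ (U r x)) := by
    funext r
    have h4 := hU.add s r
    rw [add_comm, hU.add r s] at h4
    exact congrArg (fun V : H →L[ℂ] H => V x) h4
  rw [h3]
  simpa [Function.comp_def] using h2

theorem IsUnitaryGroup.norm_apply {T : H →ₗ.[ℂ] H} {U : ℝ → H →L[ℂ] H}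
    (hU : IsUnitaryGroup T U) (s : ℝ) (x : H) : ‖U s x‖ = ‖x‖ :=
  ContinuousLinearMap.norm_map_of_mem_unitary (hU.unitary s) x

/-- The unitary group generated by `-i T` is unique. -/
theorem IsUnitaryGroup.unique {T : H →ₗ.[ℂ] H} (hT : Dense (T.domain : Set H))
    {U V : ℝ → H →L[ℂ] H} (hU : IsUnitaryGroup T U) (hV : IsUnitaryGroup T V) : U = V := by
  have hre : ∀ x y : H, (x, y) ∈ T.graph →
      ⟪x, -(Complex.I • y)⟫_ℂ + ⟪-(Complex.I • y), x⟫_ℂ = 0 := by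
    intro x y hxy
    have h0 := (hU.generator x y).1 hxy
    have h := h0.inner ℂ h0
    have hc : (fun s : ℝ => ⟪U s x, U s x⟫_ℂ) = fun _ => ((‖x‖ : ℂ) ^ 2) := by
      funext s
      rw [inner_self_eq_norm_sq_to_K, hU.norm_apply]
      rfl
    rw [hc] at h
    have h2 := h.unique (hasDerivAt_const (0 : ℝ) ((‖x‖ : ℂ) ^ 2))
    rw [hU.zero] at h2
    exact h2
  funext s
  refine ContinuousLinearMap.ext_on (s := (T.domain : Set H)) ?_ ?_
  · rw [Submodule.span_eq]
    exact hT
  intro x hx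
  obtain ⟨y, hxy⟩ := LinearPMap.mem_domain_iff.1 hx
  have hd : ∀ r : ℝ, HasDerivAt (fun q : ℝ => ⟪U q x - V q x, U q x - V q x⟫_ℂ) 0 r := by
    intro r
    have hw : HasDerivAt (fun q : ℝ => U q x - V q x) (-(Complex.I • (U r y - V r y))) r := by
      have h := (hU.hasDerivAt hxy r).sub (hV.hasDerivAt hxy r)
      have he : -(Complex.I • U r y) - -(Complex.I • V r y) =
          -(Complex.I • (U r y - V r y)) := by
        rw [smul_sub]
        abel
      rw [he] at h
      exact h
    have h := hw.inner ℂ hw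
    rw [hre _ _ (T.graph.sub_mem (hU.mem_graph hxy r) (hV.mem_graph hxy r))] at h
    exact h
  have hconst := is_const_of_deriv_eq_zero (fun r => (hd r).differentiableAt)
    (fun r => (hd r).deriv) s 0
  simp only [hU.zero, hV.zero, sub_self, inner_zero_right] at hconst
  exact sub_eq_zero.1 (inner_self_eq_zero.1 hconst)

open scoped Classical in
/-- The operator exponential `e^{-i τ T}` of a selfadjoint operator `T`: the unitary group
generated by `-i T` (with the value `0` if there is no such group). -/
def expNegI (T : H →ₗ.[ℂ] H) (τ : ℝ) : H →L[ℂ] H :=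
  if h : ∃ U : ℝ → H →L[ℂ] H, IsUnitaryGroup T U then h.choose τ else 0

end Unbounded

/-- The data of a polynomial pencil `X(t) = X₀ + t X₁ + ⋯ + t^(p-1) X_{p-1} + t^p X_p`:
possibly unbounded operators `X j` (only `j < p` matters), with `X 0` densely defined and closed,
and an everywhere defined bounded operator `top = X_p`. -/
structure Pencil (H K : Type*)
    [NormedAddCommGroup H] [InnerProductSpace ℂ H]
    [NormedAddCommGroup K] [InnerProductSpace ℂ K] where
  X : ℕ → H →ₗ.[ℂ] K
  top : H →L[ℂ] K
  dense_domain : Dense ((X 0).domain : Set H)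
  isClosed : (X 0).IsClosed

namespace Pencil

variable {H K : Type*}
  [NormedAddCommGroup H] [InnerProductSpace ℂ H]
  [NormedAddCommGroup K] [InnerProductSpace ℂ K]

/-- The operator `X(t)`, on the intersection of the domains of its terms. -/
def op (Q : Pencil H K) (p : ℕ) (t : ℝ) : H →ₗ.[ℂ] K :=
  (∑ j ∈ Finset.range p, ((t : ℂ) ^ j) • Q.X j) +
    (((t : ℂ) ^ p • Q.top : H →L[ℂ] K) : H →ₗ[ℂ] K).toPMap ⊤

/-- `Dom X(t) = Dom X₀ ⊂ Dom X_j` for all `j` and all real `t` (`X_p` is defined everywhere). -/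
def DomainCondition (Q : Pencil H K) (p : ℕ) : Prop :=
  (∀ j < p, (Q.X 0).domain ≤ (Q.X j).domain) ∧ ∀ t : ℝ, (Q.op p t).domain = (Q.X 0).domain

/-- `‖X_j u‖ ≤ C₀ ‖X₀ u‖` for all `j < p` and `u ∈ Dom X₀`. -/
def SubordinationCondition (Q : Pencil H K) (p : ℕ) (C₀ : ℝ) : Prop :=
  ∀ j < p, ∀ (u : H) (h₀ : u ∈ (Q.X 0).domain) (hj : u ∈ (Q.X j).domain),
    ‖Q.X j ⟨u, hj⟩‖ ≤ C₀ * ‖Q.X 0 ⟨u, h₀⟩‖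

variable [CompleteSpace H]

/-- `𝔑 = Ker X₀`. -/
def N (Q : Pencil H K) : Submodule ℂ H := kernel (Q.X 0)

/-- `𝔑_* = Ker X₀*`. -/
def NStar (Q : Pencil H K) : Submodule ℂ K := kernel ((Q.X 0)†)

instance (Q : Pencil H K) : CompleteSpace Q.N :=
  (isClosed_kernel Q.isClosed).completeSpace_coe

instance [CompleteSpace K] (Q : Pencil H K) : CompleteSpace Q.NStar :=
  (isClosed_kernel (LinearPMap.adjoint_isClosed Q.dense_domain)).completeSpace_coe

/-- The operator `A(t) = X(t)* X(t)`. -/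
def A (Q : Pencil H K) (p : ℕ) (t : ℝ) : H →ₗ.[ℂ] H := adjointMulSelf (Q.op p t)

/-- The operator `A₀ = X₀* X₀`. -/
def A₀ (Q : Pencil H K) : H →ₗ.[ℂ] H := adjointMulSelf (Q.X 0)

/-- `0` is an isolated point of the spectrum of `A₀`, and
`n = dim 𝔑 < ∞`, `n ≤ dim 𝔑_* ≤ ∞`. -/
def SpectralCondition (Q : Pencil H K) : Prop :=
  (∃ r > 0, unboundedSpectrum Q.A₀ ∩ Metric.ball 0 r = {0}) ∧
    FiniteDimensional ℂ Q.N ∧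
    ((Module.finrank ℂ Q.N : ℕ) : Cardinal) ≤ Module.rank ℂ Q.NStar

/-- The distance `d⁰` from `0` to the rest of the spectrum of `A₀` (`∞` if there is no rest). -/
def gap (Q : Pencil H K) : ENNReal := Metric.infEDist 0 (unboundedSpectrum Q.A₀ \ {0})

/-- The orthogonal projection `P` of `H` onto `𝔑`. -/
def P (Q : Pencil H K) : H →L[ℂ] H := Q.N.starProjection

variable [CompleteSpace K]

/-- The operator `R = P_* X_p |_𝔑 : 𝔑 → 𝔑_*`. -/
def R (Q : Pencil H K) : Q.N →L[ℂ] Q.NStar :=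
  Q.NStar.orthogonalProjectionOnto ∘L Q.top ∘L Q.N.subtypeL

/-- The defining relation `R ω = X₀ ψ + X_p ω`, where `ψ ∈ Dom X₀ ∩ 𝔑ᗮ` is the weak solution of
`X₀* (X₀ ψ + X_p ω) = 0`. -/
theorem R_apply_eq (Q : Pencil H K) (ω : Q.N) (ψ : (Q.X 0).domain)
    (hψ : ∀ ζ : (Q.X 0).domain, (ζ : H) ∈ Q.Nᗮ →
      ⟪Q.X 0 ψ, Q.X 0 ζ⟫_ℂ = ⟪-Q.top (ω : H), Q.X 0 ζ⟫_ℂ) :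
    (Q.R ω : K) = Q.X 0 ψ + Q.top (ω : H) := by
  have hweak : ∀ ζ : (Q.X 0).domain, ⟪Q.X 0 ψ + Q.top (ω : H), Q.X 0 ζ⟫_ℂ = 0 := by
    intro ζ
    obtain ⟨n, hn, hn0⟩ := (LinearPMap.mem_graph_iff _).1
      ((mem_kernel_iff (Q.X 0) _).1 (Q.N.starProjection_apply_mem (ζ : H)))
    have h := hψ (ζ - n) (by
      have h1 := Q.N.sub_starProjection_mem_orthogonal (ζ : H)
      rw [AddSubgroupClass.coe_sub, hn]
      exact h1)
    rw [LinearPMap.map_sub, hn0, sub_zero] at h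
    rw [inner_add_left, h, inner_neg_left, neg_add_cancel]
  refine Submodule.eq_starProjection_of_mem_orthogonal (K := Q.NStar) ?_ ?_
  · have hm : Q.X 0 ψ + Q.top (ω : H) ∈ (Q.X 0)†.domain :=
      LinearPMap.mem_adjoint_domain_of_exists _ ⟨0, fun x => by rw [hweak x, inner_zero_left]⟩
    refine (mem_kernel_iff _ _).2 ((LinearPMap.mem_graph_iff _).2 ⟨⟨_, hm⟩, rfl, ?_⟩)
    exact LinearPMap.adjoint_apply_eq Q.dense_domain _
      (fun x => by rw [inner_zero_left]; exact (hweak x).symm)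
  · intro v hv
    obtain ⟨w, hw, hw0⟩ := (LinearPMap.mem_graph_iff _).1 ((mem_kernel_iff _ _).1 hv)
    have h := LinearPMap.adjoint_isFormalAdjoint Q.dense_domain w ψ
    rw [hw0, inner_zero_left, hw] at h
    change ⟪v, Q.top (ω : H) - (Q.X 0 ψ + Q.top (ω : H))⟫_ℂ = 0
    rw [sub_add_cancel_right, inner_neg_right, ← h, neg_zero]

/-- The spectral germ `S = R* R : 𝔑 → 𝔑`. -/
def S (Q : Pencil H K) : Q.N →L[ℂ] Q.N := (ContinuousLinearMap.adjoint Q.R) ∘L Q.R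

/-- The operator `S P` as a bounded operator in `H`. -/
def SP (Q : Pencil H K) : H →L[ℂ] H :=
  Q.N.subtypeL ∘L Q.S ∘L Q.N.orthogonalProjectionOnto

/-- `J(t, τ) = (e^{-i τ A(t)} - e^{-i τ t^{2p} S P}) P`. -/
def J (Q : Pencil H K) (p : ℕ) (t τ : ℝ) : H →L[ℂ] H :=
  (expNegI (Q.A p t) τ -
    NormedSpace.exp ((-(Complex.I * (τ : ℂ) * (t : ℂ) ^ (2 * p))) • Q.SP)) ∘L Q.P

end Pencil

end OperatorPencil

end

/-! On `𝔑` subordination forces every `X_j` with `j < p` to vanish, so `X(t)` acts there exactly as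
`t^p X_p` (`op_apply_of_mem_N`). On `𝔑ᗮ` the spectral gap gives `‖X₀u‖ ≥ 6√δ‖u‖`, and smallness of
`t` transfers a lower bound to `X(t)`.

Let `Π_t` be the projection onto the closed subspace `X(t)(Dom X₀ ∩ 𝔑ᗮ)`. Correcting `P` by the
inverse of `X(t)` on that subspace produces an operator `L` with `‖L - P‖ ≤ C_T|t|` and the exact
identity `A(t)L = t^{2p} P X_p*(1 - Π_t) X_p P`; this is a Schur complement
(`exists_schur_complement`). At `t = 0` the compression on the right is `SP`, because `1 - Π₀ = P_*`
(`SP_eq`). The ranges move by `O(|t|)`, hence so do the projections (`norm_projection_sub_le`), and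
`A(t)L - L t^{2p}SP = O(|t|^{2p+1})` (`exists_intertwining`).

A Duhamel argument (`norm_group_intertwining_le`) turns this into `e^{-iτA(t)}L - L e^{-iτt^{2p}SP}
= O(|τ||t|^{2p+1})`. Replacing `L` by `P` on both sides costs `2C_T|t|` (`norm_J_le`), and
substituting `τε^{-2p}` for `τ` gives the claim. No spectral projection of `A(t)` is used.

The unbounded operator theory is reduced to the bounded operator `B = (1 + T*T)⁻¹`: the gap estimate
and the unitary group both come from continuous functional calculus of `B`. -/

open scoped LinearPMap InnerProductSpace

noncomputable section

namespace OperatorPencil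

/-! ### The operator `T*T` and its resolvent at `-1`. -/

section SelfadjointSquare

variable {H K : Type*}
  [NormedAddCommGroup H] [InnerProductSpace ℂ H]
  [NormedAddCommGroup K] [InnerProductSpace ℂ K]

/-- `T* T` is the operator associated with the form `⟪T x, T v⟫`. -/
theorem mem_graph_adjointMulSelf_iff [CompleteSpace H] {T : H →ₗ.[ℂ] K}
    (hd : Dense (T.domain : Set H)) {x y : H} :
    (x, y) ∈ (adjointMulSelf T).graph ↔
      ∃ hx : x ∈ T.domain, ∀ v : T.domain, ⟪T ⟨x, hx⟩, T v⟫_ℂ = ⟪y, v⟫_ℂ := by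
  rw [LinearPMap.mem_graph_iff]
  constructor
  · rintro ⟨⟨z, hz⟩, rfl, rfl⟩
    obtain ⟨⟨w, hw, hwz⟩, hz2⟩ := hz
    obtain rfl : (w : H) = z := hwz
    refine ⟨hz2, fun v => ?_⟩
    exact (LinearPMap.adjoint_isFormalAdjoint hd ⟨T w, hw⟩ v).symm
  · rintro ⟨hx, h⟩
    have hm : T ⟨x, hx⟩ ∈ (T†).domain :=
      LinearPMap.mem_adjoint_domain_of_exists _ ⟨y, fun v => (h v).symm⟩
    refine ⟨⟨x, ⟨⟨x, hx⟩, hm, rfl⟩, hx⟩, rfl, ?_⟩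
    exact LinearPMap.adjoint_apply_eq hd ⟨_, hm⟩ (fun v => (h v).symm)

/-- The graph of `T` as a subspace of the Hilbert sum of `H` and `K`. -/
def graphSpace (T : H →ₗ.[ℂ] K) : Submodule ℂ (WithLp 2 (H × K)) :=
  T.graph.comap (WithLp.linearEquiv 2 ℂ (H × K)).toLinearMap

theorem completeSpace_graphSpace [CompleteSpace H] [CompleteSpace K] {T : H →ₗ.[ℂ] K}
    (hT : T.IsClosed) : CompleteSpace (graphSpace T) := by
  have h : IsClosed (graphSpace T : Set (WithLp 2 (H × K))) :=
    IsClosed.preimage (WithLp.prod_continuous_ofLp 2 H K) hT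
  exact h.completeSpace_coe

/-- The projection of the graph of `T` to the first component. -/
def graphFst (T : H →ₗ.[ℂ] K) : graphSpace T →L[ℂ] H :=
  WithLp.fstL 2 ℂ H K ∘L (graphSpace T).subtypeL

/-- `B = (1 + T* T)⁻¹`. -/
structure IsResolventNegOne [CompleteSpace H] (T : H →ₗ.[ℂ] K) (B : H →L[ℂ] H) : Prop where
  isPositive : B.IsPositive
  norm_le : ‖B‖ ≤ 1
  mem_graph_iff : ∀ x y : H, (x, y) ∈ (adjointMulSelf T).graph ↔ B (x + y) = x

/-- The closed graph of `T` is a Hilbert space, and its projection `j` to `H` is a contraction. The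
vector `j* f` is the pair `(u, Tu)` with `⟪u, v⟫ + ⟪Tu, Tv⟫ = ⟪f, v⟫` for all `v` in the domain,
that is `(1 + T*T)u = f`. Hence `B = j j*`, and positivity and `‖B‖ ≤ 1` are immediate. -/
theorem exists_isResolventNegOne [CompleteSpace H] [CompleteSpace K] {T : H →ₗ.[ℂ] K}
    (hT : T.IsClosed) (hd : Dense (T.domain : Set H)) :
    ∃ B : H →L[ℂ] H, IsResolventNegOne T B := by
  have := completeSpace_graphSpace hT
  set j := graphFst T
  have hj : ‖j‖ ≤ 1 := by
    refine j.opNorm_le_bound zero_le_one fun x => ?_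
    rw [one_mul]
    exact WithLp.norm_fst_le H (x : WithLp 2 (H × K))
  have hkey : ∀ (f : H) (v : T.domain),
      ⟪f, v⟫_ℂ = ⟪((ContinuousLinearMap.adjoint j f : graphSpace T) : WithLp 2 (H × K)).fst, v⟫_ℂ +
        ⟪((ContinuousLinearMap.adjoint j f : graphSpace T) : WithLp 2 (H × K)).snd, T v⟫_ℂ := by
    intro f v
    have := ContinuousLinearMap.adjoint_inner_left j
      ⟨WithLp.toLp 2 ((v : H), T v), LinearPMap.mem_graph T v⟩ f
    exact this.symm
  refine ⟨j ∘L ContinuousLinearMap.adjoint j, ?_, ?_, fun x y => ?_⟩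
  · exact ContinuousLinearMap.isPositive_self_comp_adjoint j
  · refine (ContinuousLinearMap.opNorm_comp_le _ _).trans ?_
    rw [LinearIsometryEquiv.norm_map]
    exact mul_le_one₀ hj (by positivity) hj
  · rw [mem_graph_adjointMulSelf_iff hd]
    constructor
    · rintro ⟨hx, h⟩
      have : ContinuousLinearMap.adjoint j (x + y) =
          ⟨WithLp.toLp 2 (x, T ⟨x, hx⟩), LinearPMap.mem_graph T ⟨x, hx⟩⟩ := by
        refine ext_inner_right ℂ fun w => ?_
        obtain ⟨v, hv1, hv2⟩ := (LinearPMap.mem_graph_iff T).1 w.2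
        rw [ContinuousLinearMap.adjoint_inner_left]
        change ⟪x + y, (w : WithLp 2 (H × K)).fst⟫_ℂ =
          ⟪x, (w : WithLp 2 (H × K)).fst⟫_ℂ + ⟪T ⟨x, hx⟩, (w : WithLp 2 (H × K)).snd⟫_ℂ
        change (v : H) = (w : WithLp 2 (H × K)).fst at hv1
        change T v = (w : WithLp 2 (H × K)).snd at hv2
        rw [← hv1, ← hv2, h v, inner_add_left]
      change j (ContinuousLinearMap.adjoint j (x + y)) = x
      rw [this]
      rfl
    · intro h
      change ((ContinuousLinearMap.adjoint j (x + y) : graphSpace T) :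
        WithLp 2 (H × K)).fst = x at h
      obtain ⟨v, hv1, hv2⟩ := (LinearPMap.mem_graph_iff T).1
        (ContinuousLinearMap.adjoint j (x + y)).2
      change (v : H) = ((ContinuousLinearMap.adjoint j (x + y) : graphSpace T) :
        WithLp 2 (H × K)).fst at hv1
      change T v = ((ContinuousLinearMap.adjoint j (x + y) : graphSpace T) :
        WithLp 2 (H × K)).snd at hv2
      rw [h] at hv1
      obtain rfl := hv1
      refine ⟨v.2, fun w => ?_⟩
      have := hkey (v + y) w
      rw [h, ← hv2, inner_add_left] at this
      exact (add_left_cancel this).symm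

namespace IsResolventNegOne

variable [CompleteSpace H] {T : H →ₗ.[ℂ] K} {B : H →L[ℂ] H}

theorem graph_apply (hB : IsResolventNegOne T B) (f : H) :
    (B f, f - B f) ∈ (adjointMulSelf T).graph := by
  rw [hB.mem_graph_iff, add_sub_cancel]

theorem injective (hB : IsResolventNegOne T B) : Function.Injective B := by
  refine (injective_iff_map_eq_zero B).2 fun f hf => ?_
  have h := hB.graph_apply f
  rw [hf, sub_zero] at h
  exact LinearPMap.graph_fst_eq_zero_snd _ h rfl

theorem isSelfAdjoint (hB : IsResolventNegOne T B) : IsSelfAdjoint B :=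
  hB.isPositive.isSelfAdjoint

/-- For selfadjoint `B` the orthogonal complement of the range is the kernel, which is trivial. -/
theorem denseRange (hB : IsResolventNegOne T B) : DenseRange B := by
  have h : B.rangeᗮ = ⊥ := by
    rw [ContinuousLinearMap.orthogonal_range]
    rw [ContinuousLinearMap.isSelfAdjoint_iff'.1 hB.isSelfAdjoint]
    exact LinearMap.ker_eq_bot.2 hB.injective
  have h2 := (Submodule.topologicalClosure_eq_top_iff).2 h
  have h3 := (Submodule.dense_iff_topologicalClosure_eq_top).2 h2
  rwa [LinearMap.coe_range] at h3

theorem dense_domain (hB : IsResolventNegOne T B) :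
    Dense ((adjointMulSelf T).domain : Set H) := by
  refine hB.denseRange.mono ?_
  rintro _ ⟨f, rfl⟩
  exact LinearPMap.mem_domain_of_mem_graph (hB.graph_apply f)

theorem spectrum_subset (hB : IsResolventNegOne T B) :
    spectrum ℝ B ⊆ Set.Icc 0 1 := by
  intro μ hμ
  refine ⟨spectrum_nonneg_of_nonneg
    ((ContinuousLinearMap.nonneg_iff_isPositive B).2 hB.isPositive) hμ, ?_⟩
  rcases subsingleton_or_nontrivial H with h | h
  · rw [spectrum.of_subsingleton] at hμ
    exact hμ.elim
  · have := spectrum.norm_le_norm_of_mem hμ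
    exact (le_abs_self μ).trans (this.trans hB.norm_le)

end IsResolventNegOne

end SelfadjointSquare

/-! ### From a spectral gap of `T*T` to a lower bound for `T`. -/

theorem norm_sub_real_smul_sq {V : Type*} [NormedAddCommGroup V] [InnerProductSpace ℂ V]
    (s : ℝ) (v w : V) :
    ‖w - (s : ℂ) • v‖ ^ 2 = ‖w‖ ^ 2 - 2 * (s * (⟪v, w⟫_ℂ).re) + s ^ 2 * (⟪v, v⟫_ℂ).re := by
  have hv : (⟪v, v⟫_ℂ).re = ‖v‖ ^ 2 := inner_self_eq_norm_sq (𝕜 := ℂ) v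
  have hs : (⟪v, w⟫_ℂ).re = (⟪w, v⟫_ℂ).re := inner_re_symm (𝕜 := ℂ) v w
  rw [norm_sub_sq (𝕜 := ℂ), norm_smul, inner_smul_right, Complex.norm_real, hv, hs, mul_pow,
    Real.norm_eq_abs, sq_abs]
  simp

namespace IsResolventNegOne

variable {H K : Type*}
  [NormedAddCommGroup H] [InnerProductSpace ℂ H] [CompleteSpace H]
  [NormedAddCommGroup K] [InnerProductSpace ℂ K]
  {T : H →ₗ.[ℂ] K} {B : H →L[ℂ] H}

/-- With `A = T*T` one has `AB = 1 - B`, so `(A - z)B = 1 - (1 + z)B`; bijectivity of `A - z` passes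
to the right-hand side. -/
theorem isUnit_of_isResolventPoint (hB : IsResolventNegOne T B) {z : ℂ}
    (hz : IsResolventPoint (adjointMulSelf T) z) : IsUnit (1 - (1 + z) • B) := by
  obtain ⟨C, hC1, hC2⟩ := hz
  have happ : ∀ (f : H) (x : (adjointMulSelf T).domain), (x : H) = B f →
      adjointMulSelf T x - z • (x : H) = (1 - (1 + z) • B) f := by
    intro f x hx
    have h := (adjointMulSelf T).mem_graph x
    rw [hx] at h
    rw [LinearPMap.mem_graph_snd_inj _ h (hB.graph_apply f) rfl, hx]
    simp only [sub_apply, one_apply_eq_self, smul_apply]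
    rw [add_smul, one_smul, sub_sub]
  rw [ContinuousLinearMap.isUnit_iff_bijective]
  constructor
  · refine (injective_iff_map_eq_zero _).2 fun f hf => ?_
    have hx := LinearPMap.mem_domain_of_mem_graph (hB.graph_apply f)
    have h := hC1 ⟨B f, hx⟩
    rw [happ f _ rfl, hf, map_zero] at h
    exact hB.injective (by rw [map_zero]; exact h.symm)
  · intro y
    obtain ⟨x, -, hx⟩ := hC2 y
    have h := (hB.mem_graph_iff _ _).1 ((adjointMulSelf T).mem_graph x)
    exact ⟨_, by rw [← happ _ x h.symm, hx]⟩

/-- A point `μ` of the spectrum of `B` corresponds to `λ = μ⁻¹ - 1` in the spectrum of `T*T`,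
through `μ - B = μ(1 - (1 + λ)B)`. The gap `0 < λ < r` becomes the gap `(1 + r)⁻¹ < μ < 1`. -/
theorem spectrum_gap (hB : IsResolventNegOne T B) {r : ℝ}
    (hr : ∀ z ∈ unboundedSpectrum (adjointMulSelf T), z ≠ 0 → r ≤ ‖z‖)
    {μ : ℝ} (hμ : μ ∈ spectrum ℝ B) : μ = 1 ∨ (1 + r) * μ ≤ 1 := by
  by_contra! hcon
  obtain ⟨h0, h1⟩ := hB.spectrum_subset hμ
  have hμ0 : 0 < μ := by
    rcases h0.eq_or_lt with h | h
    · rw [← h, mul_zero] at hcon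
      linarith [hcon.2]
    · exact h
  have hμ1 : μ < 1 := lt_of_le_of_ne h1 hcon.1
  have hz0 : 0 < μ⁻¹ - 1 := by
    rw [sub_pos]
    exact (one_lt_inv₀ hμ0).2 hμ1
  have hz1 : μ⁻¹ - 1 < r := by
    have : μ⁻¹ < 1 + r := by
      rw [inv_lt_iff_one_lt_mul₀ hμ0, mul_comm]
      linarith [hcon.2]
    linarith
  have hres : IsResolventPoint (adjointMulSelf T) ((μ⁻¹ - 1 : ℝ) : ℂ) := by
    by_contra hn
    have h := hr _ hn (by exact_mod_cast hz0.ne')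
    rw [Complex.norm_real, Real.norm_of_nonneg hz0.le] at h
    linarith
  have hu := hB.isUnit_of_isResolventPoint hres
  apply hμ
  have he : algebraMap ℝ (H →L[ℂ] H) μ - B =
      algebraMap ℝ (H →L[ℂ] H) μ * (1 - (1 + ((μ⁻¹ - 1 : ℝ) : ℂ)) • B) := by
    ext f
    have hc : (μ : ℂ) ≠ 0 := by exact_mod_cast hμ0.ne'
    simp only [Algebra.algebraMap_eq_smul_one, sub_apply,
      smul_apply, one_apply_eq_self,
      mul_apply_eq_comp, smul_sub]
    rw [← Complex.coe_smul μ ((1 + ((μ⁻¹ - 1 : ℝ) : ℂ)) • B f), smul_smul]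
    congr 1
    push_cast
    rw [add_sub_cancel, mul_inv_cancel₀ hc, one_smul]
  change IsUnit (algebraMap ℝ (H →L[ℂ] H) μ - B)
  rw [he]
  exact IsUnit.mul ((IsUnit.mk0 μ hμ0.ne').map (algebraMap ℝ (H →L[ℂ] H))) hu

/-- The polynomial `(1 - μ)²(1 - (1 + r)μ)` is nonnegative on the spectrum of `B`, so `1 - (1 + r)B`
is nonnegative on the range of `1 - B`. The closure of that range is `(ker (1 - B))ᗮ`, which
contains `(ker T)ᗮ`. This avoids discontinuous spectral projections. -/
theorem re_inner_le_of_mem_orthogonal (hB : IsResolventNegOne T B)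
    (hd : Dense (T.domain : Set H)) {r : ℝ}
    (hr : ∀ z ∈ unboundedSpectrum (adjointMulSelf T), z ≠ 0 → r ≤ ‖z‖)
    {g : H} (hg : g ∈ (kernel T)ᗮ) :
    (1 + r) * (⟪B g, g⟫_ℂ).re ≤ ‖g‖ ^ 2 := by
  have hsa := hB.isSelfAdjoint
  set C : H →L[ℂ] H := 1 - B
  set D : H →L[ℂ] H := 1 - (1 + r) • B
  have hC : IsSelfAdjoint C := (IsSelfAdjoint.one _).sub hsa
  have hpos : 0 ≤ C * D * C := by
    have hq : cfc (fun μ : ℝ => (1 - μ) * (1 - (1 + r) * μ) * (1 - μ)) B = C * D * C := by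
      have h1 : cfc (fun μ : ℝ => 1 - μ) B = C := by
        rw [cfc_sub (fun _ => 1) (fun μ => μ) B, cfc_const_one ℝ B, cfc_id' ℝ B]
      have h2 : cfc (fun μ : ℝ => 1 - (1 + r) * μ) B = D := by
        rw [cfc_sub (fun _ => 1) (fun μ => (1 + r) * μ) B, cfc_const_one ℝ B,
          cfc_const_mul_id (1 + r) B]
      rw [cfc_mul _ _ B, cfc_mul _ _ B, h1, h2]
    rw [← hq]
    refine cfc_nonneg fun μ hμ => ?_
    rcases hB.spectrum_gap hr hμ with h | h
    · rw [h]; simp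
    · nlinarith [sq_nonneg (1 - μ), mul_nonneg (sq_nonneg (1 - μ)) (sub_nonneg.2 h)]
  rw [ContinuousLinearMap.nonneg_iff_isPositive] at hpos
  have hclosed : IsClosed {g : H | 0 ≤ (⟪D g, g⟫_ℂ).re} :=
    isClosed_le continuous_const (by fun_prop)
  have hker : C.ker ≤ kernel T := by
    intro f hf
    have hf' : f - B f = 0 := hf
    have h := hB.graph_apply f
    rw [hf', ← sub_eq_zero.1 hf'] at h
    obtain ⟨hx, h⟩ := (mem_graph_adjointMulSelf_iff hd).1 h
    have h2 := h ⟨f, hx⟩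
    rw [inner_zero_left] at h2
    rw [mem_kernel_iff, ← inner_self_eq_zero.1 h2]
    exact T.mem_graph ⟨f, hx⟩
  have hg2 : g ∈ C.kerᗮ := Submodule.orthogonal_le hker hg
  rw [ContinuousLinearMap.orthogonal_ker, ContinuousLinearMap.isSelfAdjoint_iff'.1 hC] at hg2
  have hmem : g ∈ {g : H | 0 ≤ (⟪D g, g⟫_ℂ).re} := by
    refine closure_minimal ?_ hclosed hg2
    rintro _ ⟨f, rfl⟩
    have h := hpos.re_inner_nonneg_left f
    have h3 : ⟪(C * D * C) f, f⟫_ℂ = ⟪D (C f), C f⟫_ℂ := by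
      conv_rhs => rw [← ContinuousLinearMap.adjoint_inner_left,
        ContinuousLinearMap.isSelfAdjoint_iff'.1 hC]
      rfl
    rw [h3] at h
    exact h
  have h4 : D g = g - ((1 + r : ℝ) : ℂ) • B g :=
    congrArg (g - ·) (Complex.coe_smul (1 + r) (B g)).symm
  simp only [Set.mem_ofPred_eq, h4, inner_sub_left, inner_smul_left, Complex.conj_ofReal,
    Complex.sub_re, Complex.re_ofReal_mul] at hmem
  rw [inner_self_eq_norm_sq_to_K] at hmem
  have h5 : (((‖g‖ : ℂ)) ^ 2).re = ‖g‖ ^ 2 := by norm_cast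
  have h6 : 0 ≤ ‖g‖ ^ 2 - (1 + r) * (⟪B g, g⟫_ℂ).re := by
    rw [← h5]; exact hmem
  linarith

/-- A spectral gap of `T* T` bounds `T` from below on the orthogonal complement of its kernel. -/
theorem mul_norm_sq_le (hB : IsResolventNegOne T B)
    (hd : Dense (T.domain : Set H)) {r : ℝ} (hr0 : 0 ≤ r)
    (hr : ∀ z ∈ unboundedSpectrum (adjointMulSelf T), z ≠ 0 → r ≤ ‖z‖)
    (x : T.domain) (hx : (x : H) ∈ (kernel T)ᗮ) : r * ‖(x : H)‖ ^ 2 ≤ ‖T x‖ ^ 2 := by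
  have h1 := hB.re_inner_le_of_mem_orthogonal hd hr hx
  obtain ⟨hu, h⟩ := (mem_graph_adjointMulSelf_iff hd).1 (hB.graph_apply (x : H))
  set u : T.domain := ⟨B x, hu⟩
  have hux := congrArg Complex.re (h x)
  have huu := congrArg Complex.re (h u)
  have n1 := norm_sub_real_smul_sq (1 + r) (T u) (T x)
  have n2 := norm_sub_real_smul_sq (1 + r) (B x) (x : H)
  have p1 : 0 ≤ ‖T x - ((1 + r : ℝ) : ℂ) • T u‖ ^ 2 := by positivity
  have p2 : 0 ≤ ‖(x : H) - ((1 + r : ℝ) : ℂ) • B x‖ ^ 2 := by positivity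
  have hxx : (⟪(x : H), (x : H)⟫_ℂ).re = ‖(x : H)‖ ^ 2 := inner_self_eq_norm_sq (𝕜 := ℂ) _
  have hsym : (⟪(x : H), B x⟫_ℂ).re = (⟪B x, (x : H)⟫_ℂ).re := inner_re_symm (𝕜 := ℂ) _ _
  simp only [inner_sub_left, Complex.sub_re, hxx, u, hsym] at hux huu
  simp only [u] at n1
  rw [hux, huu] at n1
  -- Since `x` need not lie in the domain of `T*T`, the form is tested only against `u = Bx`. Adding
  -- the two squares cancels `‖Bx‖²` and leaves `‖Tx‖² - (1 + 2r)‖x‖² + (1 + r)² Re⟪Bx, x⟫ ≥ 0`;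
  -- then `h1` bounds the last term by `(1 + r)‖x‖²`.
  nlinarith

end IsResolventNegOne

/-! ### The unitary group generated by `-i T*T`. -/

section UnitaryGroup

theorem norm_exp_I_mul_sub_one_sub_le (x : ℝ) :
    ‖Complex.exp (Complex.I * x) - 1 - Complex.I * x‖ ≤ 2 * x ^ 2 := by
  have hn : ‖Complex.I * (x : ℂ)‖ = |x| := by simp
  rcases le_or_gt |x| 1 with h | h
  · refine (Complex.norm_exp_sub_one_sub_id_le (by rwa [hn])).trans ?_
    rw [hn, sq_abs]
    nlinarith [sq_nonneg x]
  · refine (norm_sub_le _ _).trans ?_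
    have h1 := Real.norm_exp_I_mul_ofReal_sub_one_le (x := x)
    rw [hn, ← sq_abs]
    rw [Real.norm_eq_abs] at h1
    nlinarith

/-- The function `e^{-i s λ} μ`, where `μ = (1 + λ)⁻¹`. -/
def phase (s μ : ℝ) : ℂ := μ * Complex.exp (Complex.I * ((-(s * (μ⁻¹ - 1)) : ℝ) : ℂ))

theorem norm_phase (s μ : ℝ) : ‖phase s μ‖ = |μ| := by
  rw [phase, norm_mul, mul_comm Complex.I, Complex.norm_exp_ofReal_mul_I, mul_one,
    Complex.norm_real, Real.norm_eq_abs]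

theorem phase_mul (s r μ : ℝ) : phase s μ * phase r μ = phase (s + r) μ * μ := by
  have h : Complex.exp (Complex.I * ((-((s + r) * (μ⁻¹ - 1)) : ℝ) : ℂ)) =
      Complex.exp (Complex.I * ((-(s * (μ⁻¹ - 1)) : ℝ) : ℂ)) *
        Complex.exp (Complex.I * ((-(r * (μ⁻¹ - 1)) : ℝ) : ℂ)) := by
    rw [← Complex.exp_add]
    congr 1
    push_cast
    ring
  rw [phase, phase, phase, h]
  ring

theorem phase_zero (μ : ℝ) : phase 0 μ = μ := by simp [phase]

theorem star_phase (s μ : ℝ) : star (phase s μ) = phase (-s) μ := by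
  rw [phase, phase, star_mul', Complex.star_def, Complex.conj_ofReal, ← Complex.exp_conj, map_mul,
    Complex.conj_I, Complex.conj_ofReal]
  congr 2
  push_cast
  ring

/-- The exponential oscillates as `μ → 0`; the factor `μ` restores continuity there, which is why
`e^{-isA}B` rather than `e^{-isA}` is built by continuous functional calculus. -/
theorem continuous_phase (s : ℝ) : Continuous (phase s) := by
  rw [continuous_iff_continuousAt]
  intro μ
  rcases eq_or_ne μ 0 with rfl | h
  · have h0 : phase s 0 = 0 := by simp [phase]
    rw [ContinuousAt, h0]
    refine squeeze_zero_norm (a := fun μ : ℝ => |μ|) (fun μ => (norm_phase s μ).le) ?_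
    have : Filter.Tendsto (fun μ : ℝ => |μ|) (nhds 0) (nhds |0|) := continuous_abs.tendsto 0
    simpa using this
  · unfold phase
    have : ContinuousAt (fun μ : ℝ => μ⁻¹) μ := continuousAt_inv₀ h
    fun_prop

theorem norm_phase_sub_le (s : ℝ) {μ : ℝ} (h0 : 0 ≤ μ) (h1 : μ ≤ 1) :
    ‖phase s μ - μ‖ ≤ |s| := by
  rcases h0.eq_or_lt with rfl | h
  · simp [phase]
  have h2 : phase s μ - μ =
      μ * (Complex.exp (Complex.I * ((-(s * (μ⁻¹ - 1)) : ℝ) : ℂ)) - 1) := by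
    rw [phase]; ring
  have h3 := Real.norm_exp_I_mul_ofReal_sub_one_le (x := -(s * (μ⁻¹ - 1)))
  rw [h2, norm_mul, Complex.norm_real, Real.norm_of_nonneg h0]
  refine (mul_le_mul_of_nonneg_left h3 h0).trans ?_
  have h4 : 0 ≤ μ⁻¹ - 1 := sub_nonneg.2 ((one_le_inv₀ h).2 h1)
  rw [norm_neg, norm_mul, Real.norm_of_nonneg h4, Real.norm_eq_abs]
  have h5 : μ * (|s| * (μ⁻¹ - 1)) = |s| * (1 - μ) := by
    field_simp
  rw [h5]
  nlinarith [abs_nonneg s]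

/-- The second-order Taylor remainder of the exponential is of size `s²λ²` with `λ = μ⁻¹ - 1`. One
factor `μ` sits in `phase`; the extra one makes `μ²λ² = (1 - μ)²` bounded. -/
theorem norm_phase_deriv_le (s : ℝ) {μ : ℝ} (h0 : 0 ≤ μ) (h1 : μ ≤ 1) :
    ‖(phase s μ - μ + Complex.I * s * (1 - μ)) * μ‖ ≤ 2 * s ^ 2 := by
  rcases h0.eq_or_lt with rfl | h
  · simp; positivity
  have hμ : (μ : ℂ) ≠ 0 := by exact_mod_cast h.ne'
  have h2 : (phase s μ - μ + Complex.I * s * (1 - μ)) * μ =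
      μ ^ 2 * (Complex.exp (Complex.I * ((-(s * (μ⁻¹ - 1)) : ℝ) : ℂ)) - 1 -
        Complex.I * ((-(s * (μ⁻¹ - 1)) : ℝ) : ℂ)) := by
    have h3 : Complex.I * ((-(s * (μ⁻¹ - 1)) : ℝ) : ℂ) * μ = - (Complex.I * s * (1 - μ)) := by
      push_cast
      field_simp
    rw [phase]
    linear_combination (μ : ℂ) * h3
  rw [h2, norm_mul, norm_pow, Complex.norm_real, Real.norm_of_nonneg h0]
  refine (mul_le_mul_of_nonneg_left (norm_exp_I_mul_sub_one_sub_le _) (by positivity)).trans ?_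
  have h5 : μ ^ 2 * (2 * (-(s * (μ⁻¹ - 1))) ^ 2) = 2 * s ^ 2 * (1 - μ) ^ 2 := by
    field_simp
  rw [h5]
  have h6 : (1 - μ) ^ 2 ≤ 1 := by nlinarith
  nlinarith [sq_nonneg s]

namespace IsResolventNegOne

variable {H K : Type*}
  [NormedAddCommGroup H] [InnerProductSpace ℂ H] [CompleteSpace H]
  [NormedAddCommGroup K] [InnerProductSpace ℂ K]
  {T : H →ₗ.[ℂ] K} {B : H →L[ℂ] H}

theorem spectrum_complex (hB : IsResolventNegOne T B) {z : ℂ} (hz : z ∈ spectrum ℂ B) :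
    (z.re : ℂ) = z ∧ 0 ≤ z.re ∧ z.re ≤ 1 := by
  have h := hB.isSelfAdjoint.mem_spectrum_eq_re hz
  refine ⟨h.symm, hB.spectrum_subset ?_⟩
  rw [h] at hz
  exact (spectrum.algebraMap_mem_iff ℂ).1 hz

end IsResolventNegOne

section

variable {H : Type*} [NormedAddCommGroup H] [InnerProductSpace ℂ H] [CompleteSpace H]

/-- The operator `e^{-i s A} B`, where `B = (1 + A)⁻¹`. -/
def phaseOp (B : H →L[ℂ] H) (s : ℝ) : H →L[ℂ] H := cfc (fun z : ℂ => phase s z.re) B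

theorem continuousOn_phase_re (s : ℝ) (S : Set ℂ) :
    ContinuousOn (fun z : ℂ => phase s z.re) S :=
  ((continuous_phase s).comp Complex.continuous_re).continuousOn

end

namespace IsResolventNegOne

variable {H K : Type*}
  [NormedAddCommGroup H] [InnerProductSpace ℂ H] [CompleteSpace H]
  [NormedAddCommGroup K] [InnerProductSpace ℂ K]
  {T : H →ₗ.[ℂ] K} {B : H →L[ℂ] H}

theorem phaseOp_zero (hB : IsResolventNegOne T B) : phaseOp B 0 = B := by
  have := hB.isSelfAdjoint.isStarNormal
  conv_rhs => rw [← cfc_id' ℂ B]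
  refine cfc_congr fun z hz => ?_
  simp only [phase_zero, (hB.spectrum_complex hz).1]

theorem phaseOp_mul (hB : IsResolventNegOne T B) (s r : ℝ) :
    phaseOp B s * phaseOp B r = phaseOp B (s + r) * B := by
  have := hB.isSelfAdjoint.isStarNormal
  have h1 := cfc_mul (fun z : ℂ => phase s z.re) (fun z : ℂ => phase r z.re) B
    (continuousOn_phase_re _ _) (continuousOn_phase_re _ _)
  have h2 := cfc_mul (fun z : ℂ => phase (s + r) z.re) (fun z : ℂ => z) B
    (continuousOn_phase_re _ _) continuousOn_id
  rw [cfc_id' ℂ B] at h2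
  rw [phaseOp, phaseOp, phaseOp, ← h1, ← h2]
  refine cfc_congr fun z hz => ?_
  simp only [phase_mul, (hB.spectrum_complex hz).1]

theorem star_phaseOp (B : H →L[ℂ] H) (s : ℝ) : star (phaseOp B s) = phaseOp B (-s) := by
  rw [phaseOp, phaseOp, ← cfc_star]
  simp only [star_phase]

theorem phaseOp_comm (hB : IsResolventNegOne T B) (s : ℝ) :
    phaseOp B s * B = B * phaseOp B s := by
  have h : Commute (phaseOp B s) (phaseOp B 0) := cfc_commute_cfc _ _ B
  rwa [hB.phaseOp_zero] at h

theorem norm_phaseOp_apply (hB : IsResolventNegOne T B) (s : ℝ) (x : H) :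
    ‖phaseOp B s x‖ = ‖B x‖ := by
  have h1 : star (phaseOp B s) * phaseOp B s = star B * B := by
    rw [star_phaseOp, hB.phaseOp_mul, neg_add_cancel, hB.phaseOp_zero, hB.isSelfAdjoint.star_eq]
  have h2 : ∀ C : H →L[ℂ] H, ⟪(star C * C) x, x⟫_ℂ = (‖C x‖ : ℂ) ^ 2 := by
    intro C
    exact (ContinuousLinearMap.adjoint_inner_left C x (C x)).trans (inner_self_eq_norm_sq_to_K _)
  have h3 : ((‖phaseOp B s x‖ ^ 2 : ℝ) : ℂ) = ((‖B x‖ ^ 2 : ℝ) : ℂ) := by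
    push_cast
    rw [← h2, ← h2, h1]
  exact (sq_eq_sq₀ (norm_nonneg _) (norm_nonneg _)).1 (by exact_mod_cast h3)

theorem norm_phaseOp_sub_le (hB : IsResolventNegOne T B) (s : ℝ) : ‖phaseOp B s - B‖ ≤ |s| := by
  have := hB.isSelfAdjoint.isStarNormal
  have h1 := cfc_sub (fun z : ℂ => phase s z.re) (fun z : ℂ => z) B
    (continuousOn_phase_re _ _) continuousOn_id
  rw [cfc_id' ℂ B] at h1
  rw [phaseOp, ← h1]
  refine norm_cfc_le (abs_nonneg _) fun z hz => ?_
  obtain ⟨h2, h3, h4⟩ := hB.spectrum_complex hz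
  have := norm_phase_sub_le s h3 h4
  rwa [h2] at this

theorem norm_phaseOp_deriv_le (hB : IsResolventNegOne T B) (s : ℝ) :
    ‖(phaseOp B s - B + (Complex.I * s) • (1 - B)) * B‖ ≤ 2 * s ^ 2 := by
  have := hB.isSelfAdjoint.isStarNormal
  have hc := continuousOn_phase_re s (spectrum ℂ B)
  have h1 : cfc (fun z : ℂ => (phase s z.re - z + (Complex.I * s) * (1 - z)) * z) B =
      (phaseOp B s - B + (Complex.I * s) • (1 - B)) * B := by
    rw [cfc_mul _ _ B, cfc_add (a := B) (fun z : ℂ => phase s z.re - z)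
      (fun z => (Complex.I * s) * (1 - z)), cfc_sub _ _ B, cfc_const_mul _ _ B,
      cfc_sub _ _ B, cfc_const_one ℂ B, cfc_id' ℂ B, phaseOp]
  rw [← h1]
  refine norm_cfc_le (by positivity) fun z hz => ?_
  obtain ⟨h2, h3, h4⟩ := hB.spectrum_complex hz
  have := norm_phase_deriv_le s h3 h4
  rwa [h2] at this

/-- The remainder is `O(s²)` only on the range of `B`. A general `x` is approximated by `Bz`, and
the error is absorbed by the uniform first-order bound `‖D‖ ≤ 2|s|`. -/
theorem hasDerivAt_phaseOp_apply (hB : IsResolventNegOne T B) (x : H) :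
    HasDerivAt (fun s : ℝ => phaseOp B s x) (-(Complex.I • (x - B x))) 0 := by
  rw [hasDerivAt_iff_isLittleO, Asymptotics.isLittleO_iff]
  intro c hc
  obtain ⟨z, hz⟩ := hB.denseRange.exists_dist_lt x (show 0 < c / 4 by positivity)
  rw [dist_eq_norm] at hz
  have hev : ∀ᶠ s : ℝ in nhds 0, |s| * (2 * ‖z‖) < c / 2 := by
    have : Filter.Tendsto (fun s : ℝ => |s| * (2 * ‖z‖)) (nhds 0) (nhds (|0| * (2 * ‖z‖))) :=
      (continuous_abs.mul continuous_const).tendsto 0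
    rw [abs_zero, zero_mul] at this
    exact this.eventually_lt_const (by positivity)
  filter_upwards [hev] with s hs
  set D : H →L[ℂ] H := phaseOp B s - B + (Complex.I * s) • (1 - B)
  have h1 : phaseOp B s x - phaseOp B 0 x - (s - 0) • -(Complex.I • (x - B x)) = D x := by
    rw [hB.phaseOp_zero, sub_zero, ← Complex.coe_smul, smul_neg, smul_smul, mul_comm,
      sub_neg_eq_add]
    rfl
  have hI : ‖(1 : H →L[ℂ] H) - B‖ ≤ 1 := by
    have := hB.isSelfAdjoint.isStarNormal
    have h1 := cfc_sub (fun _ : ℂ => (1 : ℂ)) (fun z : ℂ => z) B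
      continuousOn_const continuousOn_id
    rw [cfc_id' ℂ B, cfc_const_one ℂ B] at h1
    rw [← h1]
    refine norm_cfc_le zero_le_one fun z hz => ?_
    obtain ⟨h2, h3, h4⟩ := hB.spectrum_complex hz
    rw [← h2, ← Complex.ofReal_one, ← Complex.ofReal_sub, Complex.norm_real, Real.norm_eq_abs,
      abs_le]
    constructor <;> linarith
  have hD : ‖D‖ ≤ 2 * |s| := by
    refine (norm_add_le _ _).trans ?_
    have h2 : ‖(Complex.I * (s : ℂ)) • ((1 : H →L[ℂ] H) - B)‖ ≤ |s| := by
      rw [norm_smul, norm_mul, Complex.norm_I, one_mul, Complex.norm_real, Real.norm_eq_abs]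
      exact mul_le_of_le_one_right (abs_nonneg s) hI
    linarith [hB.norm_phaseOp_sub_le s]
  have h2 : D x = D (x - B z) + (D * B) z := by
    rw [map_sub, mul_apply_eq_comp, sub_add_cancel]
  rw [h1, h2, sub_zero, Real.norm_eq_abs]
  have h3 : ‖D (x - B z)‖ ≤ 2 * |s| * (c / 4) :=
    (D.le_opNorm _).trans (mul_le_mul hD hz.le (norm_nonneg _) (by positivity))
  have h4 : ‖(D * B) z‖ ≤ 2 * s ^ 2 * ‖z‖ :=
    ((D * B).le_opNorm _).trans
      (mul_le_mul_of_nonneg_right (hB.norm_phaseOp_deriv_le s) (norm_nonneg _))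
  refine (norm_add_le _ _).trans ?_
  rw [← sq_abs] at h4
  nlinarith [abs_nonneg s]

/-- The unitary group generated by `-i T* T`. -/
theorem exists_isUnitaryGroup (hB : IsResolventNegOne T B) :
    ∃ U : ℝ → H →L[ℂ] H, IsUnitaryGroup (adjointMulSelf T) U := by
  have hdr : DenseRange (B : H →ₗ[ℂ] H) := hB.denseRange
  -- The map `Bx ↦ phaseOp B s x` is isometric on the dense range of `B`, so it extends to all of
  -- `H`.
  have hex : ∀ s : ℝ, ∃ U : H →L[ℂ] H, ∀ x, U (B x) = phaseOp B s x := fun s =>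
    ⟨(phaseOp B s : H →ₗ[ℂ] H).extendOfNorm (B : H →ₗ[ℂ] H), fun x =>
      LinearMap.extendOfNorm_eq hdr ⟨1, fun x => by
        rw [one_mul]; exact (hB.norm_phaseOp_apply s x).le⟩ x⟩
  choose U hU using hex
  have hcancel : ∀ V W : H →L[ℂ] H, (∀ x, V (B x) = W (B x)) → V = W := by
    intro V W h
    ext x
    exact congrFun (hB.denseRange.equalizer V.continuous W.continuous (funext h)) x
  have hnorm : ∀ s x, ‖U s x‖ = ‖x‖ := by
    intro s x
    refine hB.denseRange.induction_on x (isClosed_eq (by fun_prop) (by fun_prop)) fun y => ?_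
    rw [hU, hB.norm_phaseOp_apply]
  have hBU : ∀ s x, B (U s x) = phaseOp B s x := by
    intro s x
    have : B ∘L U s = phaseOp B s := by
      refine hcancel _ _ fun y => ?_
      change B (U s (B y)) = (phaseOp B s * B) y
      rw [hU, hB.phaseOp_comm]
      rfl
    exact DFunLike.congr_fun this x
  have hzero : U 0 = 1 := by
    refine hcancel _ _ fun x => ?_
    rw [hU, hB.phaseOp_zero]
    rfl
  have hadd : ∀ s r, U (s + r) = U s * U r := by
    intro s r
    refine hcancel _ _ fun x => hB.injective ?_
    rw [hBU, mul_apply_eq_comp, hBU, hU]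
    exact (DFunLike.congr_fun (hB.phaseOp_mul s r) x).symm
  have hstar : ∀ s, star (U s) * U s = 1 := fun s =>
    (ContinuousLinearMap.norm_map_iff_adjoint_comp_self (U s)).1 (hnorm s)
  have hinv : ∀ s, U s * U (-s) = 1 := fun s => by rw [← hadd, add_neg_cancel, hzero]
  have hunit : ∀ s, U s ∈ unitary (H →L[ℂ] H) := by
    intro s
    refine Unitary.mem_iff.2 ⟨hstar s, ?_⟩
    have : star (U s) = U (-s) := by
      rw [← mul_one (star (U s)), ← hinv s, ← mul_assoc, hstar, one_mul]
    rw [this, hinv]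
  have hlip : ∀ z s r, ‖U s (B z) - U r (B z)‖ ≤ ‖z‖ * |s - r| := by
    intro z s r
    have h1 : U s (B z) - U r (B z) = U r ((phaseOp B (s - r) - B) z) := by
      have h2 := hadd r (s - r)
      rw [add_sub_cancel] at h2
      rw [h2, sub_apply, map_sub, ← hU (s - r) z]
      rfl
    rw [h1, hnorm, mul_comm]
    exact ((phaseOp B (s - r) - B).le_opNorm z).trans
      (mul_le_mul_of_nonneg_right (hB.norm_phaseOp_sub_le _) (norm_nonneg _))
  refine ⟨U, hzero, hadd, hunit, fun x => ?_, fun x y => ?_⟩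
  · rw [Metric.continuous_iff]
    intro r ε hε
    obtain ⟨z, hz⟩ := hB.denseRange.exists_dist_lt x (show 0 < ε / 3 by positivity)
    rw [dist_eq_norm] at hz
    refine ⟨ε / 3 / (‖z‖ + 1), by positivity, fun s hs => ?_⟩
    rw [Real.dist_eq, lt_div_iff₀ (by positivity)] at hs
    rw [dist_eq_norm]
    have h1 : U s x - U r x = U s (x - B z) + (U s (B z) - U r (B z)) - U r (x - B z) := by
      rw [map_sub, map_sub]
      abel
    have h2 := (norm_sub_le (U s (x - B z) + (U s (B z) - U r (B z))) (U r (x - B z)))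
    have h3 := norm_add_le (U s (x - B z)) (U s (B z) - U r (B z))
    rw [hnorm] at h2 h3
    rw [h1]
    have h4 := hlip z s r
    nlinarith [abs_nonneg (s - r), norm_nonneg z]
  · rw [hB.mem_graph_iff]
    constructor
    · intro h
      have h1 := hB.hasDerivAt_phaseOp_apply (x + y)
      rw [h, add_sub_cancel_left] at h1
      refine h1.congr_of_eventuallyEq (Filter.Eventually.of_forall fun s => ?_)
      simp only [← hU s (x + y), h]
    -- Differentiability of `U s x` is pushed through `B`: comparing with the known derivative of `B
    -- (U s x) = phaseOp B s x` gives `By = x - Bx`, which is the graph condition.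
    · intro h
      have h1 := (B.restrictScalars ℝ).hasFDerivAt.comp_hasDerivAt (0 : ℝ) h
      have h2 : HasDerivAt (fun s : ℝ => phaseOp B s x) (B (-(Complex.I • y))) 0 := by
        refine h1.congr_of_eventuallyEq (Filter.Eventually.of_forall fun s => ?_)
        exact (hBU s x).symm
      have h3 := h2.unique (hB.hasDerivAt_phaseOp_apply x)
      rw [map_neg, map_smul, neg_inj] at h3
      rw [map_add, smul_right_injective H Complex.I_ne_zero h3]
      abel

end IsResolventNegOne

theorem isUnitaryGroup_expNegI {H : Type*} [NormedAddCommGroup H] [InnerProductSpace ℂ H]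
    [CompleteSpace H] {A : H →ₗ.[ℂ] H} (h : ∃ U : ℝ → H →L[ℂ] H, IsUnitaryGroup A U) :
    IsUnitaryGroup A (expNegI A) := by
  have : expNegI A = h.choose := by
    funext τ
    simp only [expNegI, dif_pos h]
  rw [this]
  exact h.choose_spec

end UnitaryGroup

/-! ### Closedness under perturbation and closed restricted ranges. -/

section ClosedOperators

theorem cauchySeq_of_norm_sub_le {E F : Type*} [SeminormedAddCommGroup E]
    [SeminormedAddCommGroup F] {v : ℕ → E} {b : ℕ → F} {C : ℝ} (hb : CauchySeq b)
    (h : ∀ n m, ‖v n - v m‖ ≤ C * ‖b n - b m‖) : CauchySeq v := by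
  rw [Metric.cauchySeq_iff] at hb ⊢
  intro ε hε
  obtain ⟨N, hN⟩ := hb (ε / (|C| + 1)) (by positivity)
  refine ⟨N, fun m hm n hn => ?_⟩
  have h1 := hN m hm n hn
  rw [lt_div_iff₀ (by positivity), dist_eq_norm] at h1
  rw [dist_eq_norm]
  have h2 := h m n
  nlinarith [le_abs_self C, norm_nonneg (b m - b n)]

variable {H K : Type*}
  [NormedAddCommGroup H] [InnerProductSpace ℂ H]
  [NormedAddCommGroup K] [InnerProductSpace ℂ K]

/-- After the bounded part `F` is removed, `(1 - a)‖Tx‖ ≤ ‖(S - F)x‖ ≤ (1 + a)‖Tx‖`, so the graph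
norms of `S` and `T` are equivalent. -/
theorem isClosed_of_relatively_bounded [CompleteSpace K] {T S : H →ₗ.[ℂ] K} (hT : T.IsClosed)
    (hdom : S.domain = T.domain) (F : H →L[ℂ] K) {a : ℝ} (ha : a < 1)
    (h : ∀ (u : H) (h₀ : u ∈ T.domain) (h₁ : u ∈ S.domain),
      ‖S ⟨u, h₁⟩ - T ⟨u, h₀⟩ - F u‖ ≤ a * ‖T ⟨u, h₀⟩‖) : S.IsClosed := by
  refine IsSeqClosed.isClosed fun w z hw hlim => ?_
  choose u hu1 hu2 using fun n => (LinearPMap.mem_graph_iff S).1 (hw n)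
  have hl1 : Filter.Tendsto (fun n => (u n : H)) Filter.atTop (nhds z.1) := by
    simp only [hu1]
    exact (continuous_fst.tendsto z).comp hlim
  have hl2 : Filter.Tendsto (fun n => S (u n)) Filter.atTop (nhds z.2) := by
    simp only [hu2]
    exact (continuous_snd.tendsto z).comp hlim
  have hb := hl2.sub ((F.continuous.tendsto _).comp hl1)
  have hd : ∀ n, (u n : H) ∈ T.domain := fun n => hdom ▸ (u n).2
  have hbound : ∀ (x : S.domain) (hx : (x : H) ∈ T.domain),
      ‖T ⟨x, hx⟩‖ ≤ (1 - a)⁻¹ * ‖S x - F x‖ ∧ ‖S x - F x‖ ≤ (1 + a) * ‖T ⟨x, hx⟩‖ := by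
    intro x hx
    have h1 := h x hx x.2
    have h2 : S x - F x = T ⟨x, hx⟩ + (S x - T ⟨x, hx⟩ - F x) := by abel
    have h3 : T ⟨x, hx⟩ = (S x - F x) - (S x - T ⟨x, hx⟩ - F x) := by abel
    have h4 := norm_add_le (T ⟨x, hx⟩) (S x - T ⟨x, hx⟩ - F x)
    have h5 := norm_sub_le (S x - F x) (S x - T ⟨x, hx⟩ - F x)
    rw [← h2] at h4
    rw [← h3] at h5
    have h1' : ‖S x - T ⟨x, hx⟩ - F x‖ ≤ a * ‖T ⟨x, hx⟩‖ := h1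
    refine ⟨?_, by linarith⟩
    rw [inv_mul_eq_div, le_div_iff₀ (by linarith)]
    linarith
  have hcau : CauchySeq fun n => T ⟨u n, hd n⟩ := by
    refine cauchySeq_of_norm_sub_le (C := (1 - a)⁻¹) hb.cauchySeq fun n m => ?_
    have h1 := (hbound (u n - u m) (T.domain.sub_mem (hd n) (hd m))).1
    have h2 := T.map_sub ⟨u n, hd n⟩ ⟨u m, hd m⟩
    rw [← h2]
    refine h1.trans_eq ?_
    congr 2
    rw [LinearPMap.map_sub, Submodule.coe_sub, map_sub]
    simp only [Function.comp_apply]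
    abel
  obtain ⟨y, hy⟩ := cauchySeq_tendsto_of_complete hcau
  have hzy : (z.1, y) ∈ T.graph :=
    hT.isSeqClosed (fun n => T.mem_graph ⟨u n, hd n⟩) (hl1.prodMk_nhds hy)
  have hz : z.1 ∈ T.domain := LinearPMap.mem_domain_of_mem_graph hzy
  obtain rfl : T ⟨z.1, hz⟩ = y := T.mem_graph_snd_inj (T.mem_graph ⟨z.1, hz⟩) hzy rfl
  have hzS : z.1 ∈ S.domain := hdom ▸ hz
  have hlim0 : Filter.Tendsto (fun n => S (u n) - F (u n)) Filter.atTop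
      (nhds (S ⟨z.1, hzS⟩ - F z.1)) := by
    rw [tendsto_iff_norm_sub_tendsto_zero] at hy ⊢
    refine squeeze_zero (fun n => norm_nonneg _) (fun n => ?_)
      (by simpa using hy.const_mul (1 + a))
    have h1 := (hbound (u n - ⟨z.1, hzS⟩) (T.domain.sub_mem (hd n) hz)).2
    have h2 := T.map_sub ⟨u n, hd n⟩ ⟨z.1, hz⟩
    rw [← h2]
    refine Eq.trans_le ?_ h1
    congr 1
    rw [LinearPMap.map_sub, Submodule.coe_sub, map_sub]
    abel
  have h3 := tendsto_nhds_unique hb hlim0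
  rw [sub_left_inj] at h3
  exact (LinearPMap.mem_graph_iff S).2 ⟨⟨z.1, hzS⟩, rfl, h3.symm⟩

/-- The range of the restriction of `T` to `Dom T ∩ V`. -/
def restrictedRange (T : H →ₗ.[ℂ] K) (V : Submodule ℂ H) : Submodule ℂ K :=
  LinearMap.range (T.toFun.domRestrict (V.comap T.domain.subtype))

theorem mem_restrictedRange {T : H →ₗ.[ℂ] K} {V : Submodule ℂ H} {y : K} :
    y ∈ restrictedRange T V ↔ ∃ x : T.domain, (x : H) ∈ V ∧ T x = y := by
  rw [restrictedRange, LinearMap.mem_range]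
  constructor
  · rintro ⟨x, rfl⟩
    exact ⟨x.1, x.2, rfl⟩
  · rintro ⟨x, hx, rfl⟩
    exact ⟨⟨x, hx⟩, rfl⟩

theorem completeSpace_restrictedRange [CompleteSpace H] [CompleteSpace K] {T : H →ₗ.[ℂ] K}
    (hT : T.IsClosed) {V : Submodule ℂ H} (hV : IsClosed (V : Set H)) {c : ℝ}
    (hc : ∀ x : T.domain, (x : H) ∈ V → ‖(x : H)‖ ≤ c * ‖T x‖) :
    CompleteSpace (restrictedRange T V) := by
  have h : IsClosed (restrictedRange T V : Set K) := by
    refine IsSeqClosed.isClosed fun w z hw hlim => ?_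
    choose u hu1 hu2 using fun n => mem_restrictedRange.1 (hw n)
    have hcau : CauchySeq fun n => (u n : H) := by
      refine cauchySeq_of_norm_sub_le (C := c) hlim.cauchySeq fun n m => ?_
      have h1 := hc (u n - u m) (V.sub_mem (hu1 n) (hu1 m))
      rwa [LinearPMap.map_sub, hu2, hu2] at h1
    obtain ⟨y, hy⟩ := cauchySeq_tendsto_of_complete hcau
    have hyz : (y, z) ∈ T.graph := by
      refine hT.isSeqClosed (fun n => T.mem_graph (u n)) (hy.prodMk_nhds ?_)
      simpa only [hu2] using hlim
    obtain ⟨x, hx1, hx2⟩ := (LinearPMap.mem_graph_iff T).1 hyz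
    refine mem_restrictedRange.2 ⟨x, ?_, hx2⟩
    change (x : H) = y at hx1
    rw [hx1]
    exact hV.isSeqClosed hu1 hy
  exact h.completeSpace_coe

/-- The bounded inverse of the restriction of `T` to `Dom T ∩ V`. -/
theorem exists_restricted_inverse {T : H →ₗ.[ℂ] K} {V : Submodule ℂ H} {c : ℝ}
    (hc : ∀ x : T.domain, (x : H) ∈ V → ‖(x : H)‖ ≤ c * ‖T x‖) :
    ∃ G : restrictedRange T V →L[ℂ] H,
      ∀ y, ‖G y‖ ≤ c * ‖y‖ ∧ ∃ h : G y ∈ T.domain, T ⟨G y, h⟩ = y := by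
  set T' := T.toFun.domRestrict (V.comap T.domain.subtype)
  have hinj : Function.Injective T' := by
    refine (injective_iff_map_eq_zero T').2 fun x hx => ?_
    have h1 := hc x.1 x.2
    change T x.1 = 0 at hx
    rw [hx, norm_zero, mul_zero] at h1
    exact Subtype.ext (Subtype.ext (norm_le_zero_iff.1 h1))
  set e := LinearEquiv.ofInjective T' hinj
  have he : ∀ y : restrictedRange T V, T (e.symm y).1 = y := fun y =>
    congrArg Subtype.val (e.apply_symm_apply y)
  have hb : ∀ y : restrictedRange T V, ‖((e.symm y).1 : H)‖ ≤ c * ‖y‖ := by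
    intro y
    have h1 := hc (e.symm y).1 (e.symm y).2
    rwa [he] at h1
  refine ⟨LinearMap.mkContinuous
    (T.domain.subtype ∘ₗ (V.comap T.domain.subtype).subtype ∘ₗ e.symm.toLinearMap) c hb,
    fun y => ⟨hb y, (e.symm y).1.2, he y⟩⟩

end ClosedOperators

/-! ### Distance between orthogonal projections. -/

section Projections

variable {K : Type*} [NormedAddCommGroup K] [InnerProductSpace ℂ K]

theorem norm_one_sub_starProjection_mul_le (U V : Submodule ℂ K)
    [U.HasOrthogonalProjection] [V.HasOrthogonalProjection] {η : ℝ} (hη : 0 ≤ η)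
    (h : ∀ u ∈ U, ∃ v ∈ V, ‖u - v‖ ≤ η * ‖u‖) :
    ‖(1 - V.starProjection) * U.starProjection‖ ≤ η := by
  refine ContinuousLinearMap.opNorm_le_bound _ hη fun x => ?_
  obtain ⟨v, hv, hle⟩ := h (U.starProjection x) (U.starProjection_apply_mem x)
  have h1 : ((1 - V.starProjection) * U.starProjection) x =
      Vᗮ.starProjection (U.starProjection x - v) := by
    rw [Submodule.starProjection_orthogonal', map_sub, mul_apply_eq_comp]
    have : ((1 : K →L[ℂ] K) - V.starProjection) v = 0 := by
      rw [sub_apply, one_apply_eq_self, Submodule.starProjection_eq_self_iff.2 hv, sub_self]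
    rw [this, sub_zero]
  rw [h1]
  refine (Vᗮ.norm_starProjection_apply_le _).trans (hle.trans ?_)
  exact mul_le_mul_of_nonneg_left (U.norm_starProjection_apply_le x) hη

/-- Splitting `P_U - P_V = (1 - P_V)P_U - ((1 - P_U)P_V)*` reduces the difference to the two
one-sided approximation hypotheses. -/
theorem norm_starProjection_sub_le [CompleteSpace K] (U V : Submodule ℂ K)
    [U.HasOrthogonalProjection] [V.HasOrthogonalProjection] {η : ℝ} (hη : 0 ≤ η)
    (h₁ : ∀ u ∈ U, ∃ v ∈ V, ‖u - v‖ ≤ η * ‖u‖) (h₂ : ∀ v ∈ V, ∃ u ∈ U, ‖v - u‖ ≤ η * ‖v‖) :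
    ‖U.starProjection - V.starProjection‖ ≤ 2 * η := by
  have hU : star U.starProjection = U.starProjection := isSelfAdjoint_starProjection U
  have hV : star V.starProjection = V.starProjection := isSelfAdjoint_starProjection V
  have h : U.starProjection - V.starProjection =
      (1 - V.starProjection) * U.starProjection -
        star ((1 - U.starProjection) * V.starProjection) := by
    rw [star_mul, star_sub, star_one, hU, hV]
    noncomm_ring
  rw [h]
  refine (norm_sub_le _ _).trans ?_
  rw [norm_star]
  linarith [norm_one_sub_starProjection_mul_le U V hη h₁,
    norm_one_sub_starProjection_mul_le V U hη h₂]

end Projections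

/-! ### Schur complement and intertwining of unitary groups. -/

section Intertwining

variable {H K : Type*}
  [NormedAddCommGroup H] [InnerProductSpace ℂ H] [CompleteSpace H]
  [NormedAddCommGroup K] [InnerProductSpace ℂ K] [CompleteSpace K]

/-- The Schur complement of `T* T` with respect to a subspace on which `T` coincides with a
bounded operator `F`. -/
theorem exists_schur_complement {T : H →ₗ.[ℂ] K} (hd : Dense (T.domain : Set H))
    (N : Submodule ℂ H) [N.HasOrthogonalProjection] (F : H →L[ℂ] K)
    (hN : ∀ n ∈ N, ∃ h : n ∈ T.domain, T ⟨n, h⟩ = F n) {c : ℝ} (hc0 : 0 ≤ c)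
    (hc : ∀ x : T.domain, (x : H) ∈ Nᗮ → ‖(x : H)‖ ≤ c * ‖T x‖)
    [(restrictedRange T Nᗮ).HasOrthogonalProjection] :
    ∃ L : H →L[ℂ] H, ∀ x,
      (L x, (N.starProjection * (ContinuousLinearMap.adjoint F ∘L
        (1 - (restrictedRange T Nᗮ).starProjection) ∘L F) * N.starProjection) x) ∈
        (adjointMulSelf T).graph ∧
      ‖L x - N.starProjection x‖ ≤ c * ‖F‖ * ‖x‖ := by
  set Y := restrictedRange T Nᗮ
  set P := N.starProjection
  obtain ⟨G, hG⟩ := exists_restricted_inverse hc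
  -- The correction in `Nᗮ` is chosen so that `T L x = (1 - Π)F P x` is orthogonal to `T(Dom T ∩
  -- Nᗮ)`. Pairing with `T v` then sees only `T P v = F P v`, which yields the exact value of `T*T
  -- L`.
  refine ⟨P - G ∘L Y.orthogonalProjectionOnto ∘L F ∘L P, fun x => ⟨?_, ?_⟩⟩
  · rw [mem_graph_adjointMulSelf_iff hd]
    obtain ⟨h1, h2⟩ := hN (P x) (N.starProjection_apply_mem x)
    obtain ⟨-, h3, h4⟩ := hG (Y.orthogonalProjectionOnto (F (P x)))
    refine ⟨T.domain.sub_mem h1 h3, fun v => ?_⟩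
    have h5 : T ⟨(P - G ∘L Y.orthogonalProjectionOnto ∘L F ∘L P) x, T.domain.sub_mem h1 h3⟩ =
        F (P x) - Y.starProjection (F (P x)) := by
      have := T.map_sub ⟨P x, h1⟩ ⟨_, h3⟩
      rw [h2, h4] at this
      exact this
    rw [h5]
    set w := F (P x) - Y.starProjection (F (P x))
    have hw : w ∈ Yᗮ := Y.sub_starProjection_mem_orthogonal _
    obtain ⟨h6, h7⟩ := hN (P v) (N.starProjection_apply_mem (v : H))
    have h8 : T (v - ⟨P v, h6⟩) ∈ Y :=
      mem_restrictedRange.2 ⟨_, N.sub_starProjection_mem_orthogonal (v : H), rfl⟩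
    have h9 := (Submodule.mem_orthogonal' Y w).1 hw _ h8
    rw [LinearPMap.map_sub, h7, inner_sub_right, sub_eq_zero] at h9
    rw [h9]
    change ⟪w, F (P v)⟫_ℂ = ⟪P (ContinuousLinearMap.adjoint F w), v⟫_ℂ
    rw [Submodule.inner_starProjection_left_eq_right, ContinuousLinearMap.adjoint_inner_left]
  · have h1 := (hG (Y.orthogonalProjectionOnto (F (P x)))).1
    have h2 : (P - G ∘L Y.orthogonalProjectionOnto ∘L F ∘L P) x - P x =
        - G (Y.orthogonalProjectionOnto (F (P x))) := by
      change P x - G (Y.orthogonalProjectionOnto (F (P x))) - P x = _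
      abel
    rw [h2, norm_neg]
    refine h1.trans ?_
    rw [mul_assoc]
    refine mul_le_mul_of_nonneg_left ?_ hc0
    refine (Y.norm_orthogonalProjectionOnto_apply_le _).trans ((F.le_opNorm _).trans ?_)
    exact mul_le_mul_of_nonneg_left (N.norm_starProjection_apply_le x) (norm_nonneg _)

theorem smul_neg_I_smul_mem_skewAdjoint {G : H →L[ℂ] H} (hG : IsSelfAdjoint G) (s : ℝ) :
    s • (-(Complex.I • G)) ∈ skewAdjoint (H →L[ℂ] H) :=
  skewAdjoint.smul_mem s (neg_mem (hG.I_smul_mem_skewAdjoint (K := ℂ)))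

theorem exp_mem_unitary_of_mem_skewAdjoint {G : H →L[ℂ] H}
    (hG : G ∈ skewAdjoint (H →L[ℂ] H)) : NormedSpace.exp G ∈ unitary (H →L[ℂ] H) :=
  let : NormedAlgebra ℚ (H →L[ℂ] H) := NormedAlgebra.restrictScalars ℚ ℂ (H →L[ℂ] H)
  NormedSpace.exp_mem_unitary_of_mem_skewAdjoint hG

theorem norm_exp_neg_I_smul_apply {G : H →L[ℂ] H} (hG : IsSelfAdjoint G) (s : ℝ) (x : H) :
    ‖NormedSpace.exp (s • (-(Complex.I • G))) x‖ = ‖x‖ :=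
  ContinuousLinearMap.norm_map_of_mem_unitary
    (exp_mem_unitary_of_mem_skewAdjoint (smul_neg_I_smul_mem_skewAdjoint hG s)) x

/-- An approximate intertwining relation `A L ≈ L G` implies one for the unitary groups. -/
theorem norm_group_intertwining_le {A : H →ₗ.[ℂ] H} {U : ℝ → H →L[ℂ] H}
    (hU : IsUnitaryGroup A U) (hd : Dense (A.domain : Set H))
    (hsymm : ∀ x y x' y', (x, y) ∈ A.graph → (x', y') ∈ A.graph → ⟪x, y'⟫_ℂ = ⟪y, x'⟫_ℂ)
    {G : H →L[ℂ] H} (hG : IsSelfAdjoint G) {L W : H →L[ℂ] H}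
    (hL : ∀ x, (L x, W x) ∈ A.graph) (τ : ℝ) (x : H) :
    ‖U τ (L x) - L (NormedSpace.exp (τ • (-(Complex.I • G))) x)‖ ≤
      ‖W - L * G‖ * |τ| * ‖x‖ := by
  set e : ℝ → H := fun s => NormedSpace.exp (s • (-(Complex.I • G))) x
  have he0 : e 0 = x := by simp [e]
  have hnorm : ∀ s, ‖e s‖ = ‖x‖ := fun s => norm_exp_neg_I_smul_apply hG s x
  have hde : ∀ s, HasDerivAt e (-(Complex.I • G (e s))) s := by
    intro s
    have h := hasDerivAt_exp_smul_const' (𝕂 := ℝ) (-(Complex.I • G)) s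
    exact ((ContinuousLinearMap.apply ℂ H x).restrictScalars ℝ).hasFDerivAt.comp_hasDerivAt s h
  have hdL : ∀ s, HasDerivAt (fun s => L (e s)) (-(Complex.I • L (G (e s)))) s := by
    intro s
    have h := (L.restrictScalars ℝ).hasFDerivAt.comp_hasDerivAt s (hde s)
    have h2 : L (-(Complex.I • G (e s))) = -(Complex.I • L (G (e s))) := by
      rw [map_neg, map_smul]
    rw [← h2]
    exact h
  have hiso : ∀ s (v w : H), ⟪U s v, U s w⟫_ℂ = ⟪v, w⟫_ℂ := by
    intro s v w
    rw [← ContinuousLinearMap.adjoint_inner_right]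
    have h := (Unitary.mem_iff.1 (hU.unitary s)).1
    exact congrArg (inner ℂ v) (DFunLike.congr_fun h w)
  -- Duhamel in weak form: for `y` in the domain, `s ↦ ⟪L e(s), U s y⟫` has derivative `⟪i(W -
  -- LG)e(s), U s y⟫`, since symmetry of `A` and `A L = W` move `A` off `y`. The mean value
  -- inequality, density and `y = U(-τ)z` finish the estimate.
  have hweak : ∀ y ∈ A.domain, ‖⟪L (e τ) - U τ (L x), U τ y⟫_ℂ‖ ≤
      ‖W - L * G‖ * |τ| * ‖x‖ * ‖y‖ := by
    intro y hy
    obtain ⟨y', hyy⟩ := LinearPMap.mem_domain_iff.1 hy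
    have hd : ∀ s ∈ Set.univ, HasDerivWithinAt (fun s => ⟪L (e s), U s y⟫_ℂ)
        (⟪Complex.I • (W - L * G) (e s), U s y⟫_ℂ) Set.univ s := by
      intro s _
      have h := (hdL s).inner ℂ (hU.hasDerivAt hyy s)
      have h2 := hsymm _ _ _ _ (hL (e s)) (hU.mem_graph hyy s)
      have h3 : ⟪Complex.I • (W - L * G) (e s), U s y⟫_ℂ =
          ⟪L (e s), -(Complex.I • U s y')⟫_ℂ + ⟪-(Complex.I • L (G (e s))), U s y⟫_ℂ := by
        rw [inner_neg_right, inner_smul_right, h2, inner_neg_left, inner_smul_left,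
          inner_smul_left, Complex.conj_I, sub_apply, inner_sub_left, mul_apply_eq_comp]
        ring
      rw [h3]
      exact h.hasDerivWithinAt
    have hb : ∀ s ∈ Set.univ, ‖⟪Complex.I • (W - L * G) (e s), U s y⟫_ℂ‖ ≤
        ‖W - L * G‖ * ‖x‖ * ‖y‖ := by
      intro s _
      refine (norm_inner_le_norm _ _).trans ?_
      rw [hU.norm_apply, norm_smul, Complex.norm_I, one_mul]
      refine mul_le_mul_of_nonneg_right ?_ (norm_nonneg _)
      exact ((W - L * G).le_opNorm _).trans_eq (by rw [hnorm])
    have hm := Convex.norm_image_sub_le_of_norm_hasDerivWithin_le (x := 0) (y := τ) hd hb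
      convex_univ (Set.mem_univ _) (Set.mem_univ _)
    rw [he0, hU.zero, sub_zero, Real.norm_eq_abs] at hm
    rw [inner_sub_left, hiso]
    refine hm.trans_eq ?_
    ring
  have hweak2 : ∀ y, ‖⟪L (e τ) - U τ (L x), U τ y⟫_ℂ‖ ≤ ‖W - L * G‖ * |τ| * ‖x‖ * ‖y‖ := by
    intro y
    have hcl : IsClosed {y | ‖⟪L (e τ) - U τ (L x), U τ y⟫_ℂ‖ ≤
        ‖W - L * G‖ * |τ| * ‖x‖ * ‖y‖} := isClosed_le (by fun_prop) (by fun_prop)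
    exact closure_minimal (fun y hy => hweak y hy) hcl (hd y)
  set z := L (e τ) - U τ (L x)
  have hz := hweak2 (U (-τ) z)
  have hinv : U τ (U (-τ) z) = z := by
    have := hU.add τ (-τ)
    rw [add_neg_cancel, hU.zero] at this
    exact (DFunLike.congr_fun this z).symm
  rw [hinv, hU.norm_apply, inner_self_eq_norm_sq_to_K, norm_pow, RCLike.norm_ofReal,
    abs_norm] at hz
  rw [norm_sub_rev]
  rcases (norm_nonneg z).eq_or_lt with h0 | h0
  · rw [← h0]
    positivity
  · nlinarith

end Intertwining

theorem starProjection_congr {K : Type*} [NormedAddCommGroup K] [InnerProductSpace ℂ K]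
    {U V : Submodule ℂ K} [U.HasOrthogonalProjection] [V.HasOrthogonalProjection] (h : U = V) :
    U.starProjection = V.starProjection := by
  subst h
  rfl

/-! ### Perturbation bounds for the pencil and the spectral germ. -/

namespace Pencil

variable {H K : Type*}
  [NormedAddCommGroup H] [InnerProductSpace ℂ H]
  [NormedAddCommGroup K] [InnerProductSpace ℂ K]

/-- Each of the `n - 1` terms with `1 ≤ j < n` contributes at most `|t|^j C₀‖X₀u‖ ≤ |t| C₀‖X₀u‖`. -/
theorem norm_sum_sub_le (Q : Pencil H K) {p : ℕ} {C₀ : ℝ}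
    (hs : Q.SubordinationCondition p C₀) {t : ℝ} (ht : |t| ≤ 1)
    {n : ℕ} (hn : 1 ≤ n) (hnp : n ≤ p) (u : H) (h₀ : u ∈ (Q.X 0).domain)
    (h : u ∈ (∑ j ∈ Finset.range n, ((t : ℂ) ^ j) • Q.X j).domain) :
    ‖(∑ j ∈ Finset.range n, ((t : ℂ) ^ j) • Q.X j) ⟨u, h⟩ - Q.X 0 ⟨u, h₀⟩‖ ≤
      ((n : ℝ) - 1) * C₀ * |t| * ‖Q.X 0 ⟨u, h₀⟩‖ := by
  induction n, hn using Nat.le_induction generalizing u with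
  | base =>
    revert h
    rw [Finset.sum_range_one]
    intro h
    have h1 : (((t : ℂ) ^ 0) • Q.X 0) ⟨u, h⟩ = Q.X 0 ⟨u, h₀⟩ := by
      rw [LinearPMap.smul_apply, pow_zero, one_smul]
    rw [h1]
    simp
  | succ n hn ih =>
    revert h
    rw [Finset.sum_range_succ]
    intro h
    have h1 := ih (by omega) u h₀ h.1
    have h2 := hs n (by omega) u h₀ h.2
    have h3 : ((∑ j ∈ Finset.range n, ((t : ℂ) ^ j) • Q.X j) + ((t : ℂ) ^ n) • Q.X n) ⟨u, h⟩ =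
        (∑ j ∈ Finset.range n, ((t : ℂ) ^ j) • Q.X j) ⟨u, h.1⟩ +
          ((t : ℂ) ^ n) • Q.X n ⟨u, h.2⟩ := rfl
    rw [h3, add_sub_right_comm]
    refine (norm_add_le _ _).trans ?_
    rw [norm_smul, norm_pow, Complex.norm_real, Real.norm_eq_abs]
    have h4 : |t| ^ n ≤ |t| := pow_le_of_le_one (abs_nonneg t) ht (by omega)
    have h5 := mul_le_mul h4 h2 (norm_nonneg _) (abs_nonneg t)
    push_cast
    linarith

theorem norm_op_sub_le (Q : Pencil H K) {p : ℕ} (hp : 1 ≤ p) {C₀ : ℝ}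
    (hs : Q.SubordinationCondition p C₀) {t : ℝ} (ht : |t| ≤ 1)
    (u : H) (h₀ : u ∈ (Q.X 0).domain) (h : u ∈ (Q.op p t).domain) :
    ‖Q.op p t ⟨u, h⟩ - Q.X 0 ⟨u, h₀⟩ - ((t : ℂ) ^ p • Q.top) u‖ ≤
      ((p : ℝ) - 1) * C₀ * |t| * ‖Q.X 0 ⟨u, h₀⟩‖ := by
  have h1 := Q.norm_sum_sub_le hs ht hp le_rfl u h₀ h.1
  have h2 : Q.op p t ⟨u, h⟩ = (∑ j ∈ Finset.range p, ((t : ℂ) ^ j) • Q.X j) ⟨u, h.1⟩ +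
      ((t : ℂ) ^ p • Q.top) u := rfl
  rw [h2]
  refine Eq.trans_le ?_ h1
  congr 1
  abel

theorem exists_X_zero_apply_eq_zero (Q : Pencil H K) {n : H} (hn : n ∈ Q.N) :
    ∃ h : n ∈ (Q.X 0).domain, Q.X 0 ⟨n, h⟩ = 0 := by
  obtain ⟨y, rfl, h0⟩ := (LinearPMap.mem_graph_iff _).1 ((mem_kernel_iff _ _).1 hn)
  exact ⟨y.2, h0⟩

variable [CompleteSpace H]

theorem mem_restrictedRange_orthogonal_N (Q : Pencil H K) (u : (Q.X 0).domain) :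
    Q.X 0 u ∈ restrictedRange (Q.X 0) Q.Nᗮ := by
  obtain ⟨h, h0⟩ := Q.exists_X_zero_apply_eq_zero (Q.N.starProjection_apply_mem (u : H))
  refine mem_restrictedRange.2
    ⟨u - ⟨_, h⟩, Q.N.sub_starProjection_mem_orthogonal (u : H), ?_⟩
  rw [LinearPMap.map_sub, h0, sub_zero]

/-- Restricting to `𝔑ᗮ` does not shrink the range of `X₀`, and the orthogonal complement of the full
range is `Ker X₀*`. -/
theorem restrictedRange_orthogonal (Q : Pencil H K) :
    (restrictedRange (Q.X 0) Q.Nᗮ)ᗮ = Q.NStar := by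
  ext w
  rw [Submodule.mem_orthogonal', NStar, mem_kernel_iff]
  constructor
  · intro h
    have h1 : ∀ x : (Q.X 0).domain, ⟪(0 : H), x⟫_ℂ = ⟪w, Q.X 0 x⟫_ℂ := fun x => by
      rw [inner_zero_left, h _ (Q.mem_restrictedRange_orthogonal_N x)]
    have hm : w ∈ (Q.X 0)†.domain := LinearPMap.mem_adjoint_domain_of_exists _ ⟨0, h1⟩
    exact (LinearPMap.mem_graph_iff _).2
      ⟨⟨w, hm⟩, rfl, LinearPMap.adjoint_apply_eq Q.dense_domain ⟨w, hm⟩ h1⟩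
  · intro h y hy
    obtain ⟨x, -, rfl⟩ := mem_restrictedRange.1 hy
    obtain ⟨v, hv, hv0⟩ := (LinearPMap.mem_graph_iff _).1 h
    have h1 := LinearPMap.adjoint_isFormalAdjoint Q.dense_domain v x
    rw [hv0, inner_zero_left, hv] at h1
    exact h1.symm

variable [CompleteSpace K]

/-- This identifies the germ with the Schur complement compression at `t = 0`, as `1 - Π₀ = P_*`. -/
theorem SP_eq (Q : Pencil H K) [(restrictedRange (Q.X 0) Q.Nᗮ).HasOrthogonalProjection] :
    Q.SP = Q.N.starProjection * (ContinuousLinearMap.adjoint Q.top ∘L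
        (1 - (restrictedRange (Q.X 0) Q.Nᗮ).starProjection) ∘L Q.top) * Q.N.starProjection := by
  rw [← Submodule.starProjection_orthogonal',
    starProjection_congr Q.restrictedRange_orthogonal, SP, S, R,
    ContinuousLinearMap.adjoint_comp, ContinuousLinearMap.adjoint_comp,
    Submodule.adjoint_subtypeL, Submodule.adjoint_orthogonalProjectionOnto]
  rfl

theorem gap_mul_norm_sq_le (Q : Pencil H K) {δ : ℝ} (hδ : 0 < δ)
    (hgap : ENNReal.ofReal δ ≤ Q.gap / 36) (x : (Q.X 0).domain) (hx : (x : H) ∈ Q.Nᗮ) :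
    36 * δ * ‖(x : H)‖ ^ 2 ≤ ‖Q.X 0 x‖ ^ 2 := by
  obtain ⟨B, hB⟩ := exists_isResolventNegOne Q.isClosed Q.dense_domain
  refine hB.mul_norm_sq_le Q.dense_domain (by positivity) (fun z hz hz0 => ?_) x hx
  rw [ENNReal.le_div_iff_mul_le (by simp) (by simp)] at hgap
  have h1 : Q.gap ≤ edist 0 z := Metric.infEDist_le_edist_of_mem ⟨hz, hz0⟩
  have h2 := hgap.trans h1
  rw [edist_dist, dist_zero_left, ← ENNReal.ofReal_ofNat, ← ENNReal.ofReal_mul hδ.le,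
    ENNReal.ofReal_le_ofReal_iff (norm_nonneg z)] at h2
  linarith

end Pencil

theorem inner_symm_of_mem_graph {H K : Type*}
    [NormedAddCommGroup H] [InnerProductSpace ℂ H] [CompleteSpace H]
    [NormedAddCommGroup K] [InnerProductSpace ℂ K] {T : H →ₗ.[ℂ] K}
    (hd : Dense (T.domain : Set H)) {x y x' y' : H} (h : (x, y) ∈ (adjointMulSelf T).graph)
    (h' : (x', y') ∈ (adjointMulSelf T).graph) : ⟪x, y'⟫_ℂ = ⟪y, x'⟫_ℂ := by
  obtain ⟨h1, h2⟩ := (mem_graph_adjointMulSelf_iff hd).1 h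
  obtain ⟨h3, h4⟩ := (mem_graph_adjointMulSelf_iff hd).1 h'
  rw [← h2 ⟨x', h3⟩, ← inner_conj_symm, ← h4 ⟨x, h1⟩, inner_conj_symm]

/-- Rescaling of a threshold estimate to the small parameter `ε`. -/
theorem rescaled_bound_le {p : ℕ} {t ε τ a b c : ℝ} (hε : 0 < ε) (hb : 0 ≤ b) (hc : 0 ≤ c)
    (ha : a ≤ b * |t| + c * |t| ^ (2 * p + 1) * |τ * (ε ^ (2 * p))⁻¹|) :
    a * (ε ^ (2 * p + 1) / (t ^ 2 + ε ^ 2) ^ ((p : ℝ) + 1 / 2)) ≤ (b + c * |τ|) * ε := by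
  set s := √(t ^ 2 + ε ^ 2)
  have hw : 0 ≤ t ^ 2 + ε ^ 2 := by positivity
  have hs : (t ^ 2 + ε ^ 2) ^ ((p : ℝ) + 1 / 2) = s ^ (2 * p + 1) := by
    rw [← Real.rpow_natCast s, show s = (t ^ 2 + ε ^ 2) ^ (1 / 2 : ℝ) from Real.sqrt_eq_rpow _,
      ← Real.rpow_mul hw]
    congr 1
    push_cast
    ring
  have hsε : ε ≤ s := Real.le_sqrt_of_sq_le (by nlinarith [sq_nonneg t])
  have hst : |t| ≤ s := Real.abs_le_sqrt (by nlinarith [sq_nonneg ε])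
  have hs0 : 0 < s := hε.trans_le hsε
  rw [hs, ← mul_div_assoc, div_le_iff₀ (by positivity)]
  refine (mul_le_mul_of_nonneg_right ha (by positivity)).trans ?_
  -- With `s = √(t² + ε²)` dominating both `|t|` and `ε`, each term of the bound has total degree
  -- `2p + 1` in them, apart from one spare factor `ε`.
  have h1 : |t| * ε ^ (2 * p) ≤ s ^ (2 * p + 1) := by
    rw [pow_succ']
    exact mul_le_mul hst (pow_le_pow_left₀ hε.le hsε _) (by positivity) hs0.le
  have h2 : |t| ^ (2 * p + 1) ≤ s ^ (2 * p + 1) := pow_le_pow_left₀ (abs_nonneg t) hst _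
  rw [abs_mul, abs_of_nonneg (show 0 ≤ (ε ^ (2 * p))⁻¹ by positivity)]
  have h3 : (b * |t| + c * |t| ^ (2 * p + 1) * (|τ| * (ε ^ (2 * p))⁻¹)) * ε ^ (2 * p + 1) =
      b * ε * (|t| * ε ^ (2 * p)) + c * |τ| * ε * |t| ^ (2 * p + 1) := by
    field_simp
    ring
  rw [h3]
  have h4 := mul_le_mul_of_nonneg_left h1 (show 0 ≤ b * ε by positivity)
  have h5 := mul_le_mul_of_nonneg_left h2 (show 0 ≤ c * |τ| * ε by positivity)
  linarith

namespace Pencil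

variable {H K : Type*}
  [NormedAddCommGroup H] [InnerProductSpace ℂ H] [CompleteSpace H]
  [NormedAddCommGroup K] [InnerProductSpace ℂ K] [CompleteSpace K]

theorem isUnitaryGroup_expNegI_A (Q : Pencil H K) {p : ℕ} {t : ℝ}
    (hdom : (Q.op p t).domain = (Q.X 0).domain) (hcl : (Q.op p t).IsClosed) :
    IsUnitaryGroup (Q.A p t) (expNegI (Q.A p t)) := by
  obtain ⟨B, hB⟩ := exists_isResolventNegOne hcl (by rw [hdom]; exact Q.dense_domain)
  exact isUnitaryGroup_expNegI hB.exists_isUnitaryGroup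

theorem dense_domain_A (Q : Pencil H K) {p : ℕ} {t : ℝ}
    (hdom : (Q.op p t).domain = (Q.X 0).domain) (hcl : (Q.op p t).IsClosed) :
    Dense ((Q.A p t).domain : Set H) := by
  obtain ⟨B, hB⟩ := exists_isResolventNegOne hcl (by rw [hdom]; exact Q.dense_domain)
  exact hB.dense_domain

theorem J_apply (Q : Pencil H K) (p : ℕ) (t τ : ℝ) (x : H) :
    Q.J p t τ x = expNegI (Q.A p t) τ (Q.P x) -
      NormedSpace.exp (τ • (-(Complex.I • ((t : ℂ) ^ (2 * p) • Q.SP)))) (Q.P x) := by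
  have h : τ • (-(Complex.I • ((t : ℂ) ^ (2 * p) • Q.SP))) =
      (-(Complex.I * (τ : ℂ) * (t : ℂ) ^ (2 * p))) • Q.SP := by
    rw [← Complex.coe_smul, smul_neg, smul_smul, smul_smul, neg_smul]
    congr 2
    ring
  rw [h]
  rfl

theorem isSelfAdjoint_SP (Q : Pencil H K) : IsSelfAdjoint Q.SP := by
  have h1 : Q.SP = Q.N.subtypeL ∘L Q.S ∘L ContinuousLinearMap.adjoint Q.N.subtypeL := by
    rw [Submodule.adjoint_subtypeL]
    rfl
  have h2 : IsSelfAdjoint Q.S :=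
    (ContinuousLinearMap.isPositive_adjoint_comp_self Q.R).isSelfAdjoint
  rw [h1]
  exact h2.conj_adjoint _

theorem P_mul_SP (Q : Pencil H K) : Q.P * Q.SP = Q.SP := by
  ext x
  exact Submodule.starProjection_eq_self_iff.2 (Q.S (Q.N.orthogonalProjectionOnto x)).2

theorem P_comm_SP (Q : Pencil H K) : Commute Q.P Q.SP := by
  have h := congrArg star Q.P_mul_SP
  rw [star_mul, Q.isSelfAdjoint_SP.star_eq, P,
    (isSelfAdjoint_starProjection Q.N).star_eq] at h
  exact Q.P_mul_SP.trans h.symm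

theorem exp_P_apply (Q : Pencil H K) (s : ℝ) (c : ℂ) (x : H) :
    Q.P (NormedSpace.exp (s • (-(Complex.I • (c • Q.SP)))) (Q.P x)) =
      NormedSpace.exp (s • (-(Complex.I • (c • Q.SP)))) (Q.P x) := by
  let : NormedAlgebra ℚ (H →L[ℂ] H) := NormedAlgebra.restrictScalars ℚ ℂ (H →L[ℂ] H)
  have h1 : Commute Q.P (s • (-(Complex.I • (c • Q.SP)))) :=
    (((Q.P_comm_SP.smul_right c).smul_right Complex.I).neg_right).smul_right s
  have h2 := DFunLike.congr_fun h1.exp_right.eq (Q.P x)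
  rw [mul_apply_eq_comp, mul_apply_eq_comp] at h2
  rw [h2]
  congr 1
  exact Submodule.starProjection_eq_self_iff.2 (Q.N.starProjection_apply_mem x)

end Pencil

/-! ### Threshold approximation for small `t`. -/

namespace Pencil

variable {H K : Type*}
  [NormedAddCommGroup H] [InnerProductSpace ℂ H] [CompleteSpace H]
  [NormedAddCommGroup K] [InnerProductSpace ℂ K]

/-- The smallness conditions on `t` in the threshold approximation. -/
structure IsThreshold (Q : Pencil H K) (p : ℕ) (C₀ δ t : ℝ) : Prop where
  two_le : 2 ≤ p
  domain : Q.DomainCondition p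
  one_le : 1 ≤ C₀
  subordination : Q.SubordinationCondition p C₀
  delta_pos : 0 < δ
  delta_le : δ ≤ 1 / 4
  gap : ENNReal.ofReal δ ≤ Q.gap / 36
  mul_abs_le : ((p : ℝ) - 1) * C₀ * |t| ≤ √δ
  norm_mul_abs_le : ‖Q.top‖ * |t| ≤ √δ

/-- The constant `C_T`. -/
def thresholdConst (Q : Pencil H K) (p : ℕ) (C₀ δ : ℝ) : ℝ :=
  (p : ℝ) * C₀ ^ 2 + ‖Q.top‖ ^ 2 * δ⁻¹

namespace IsThreshold

variable {Q : Pencil H K} {p : ℕ} {C₀ δ t : ℝ}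

theorem sqrt_pos (h : IsThreshold Q p C₀ δ t) : 0 < √δ := Real.sqrt_pos.2 h.delta_pos

theorem sqrt_le (h : IsThreshold Q p C₀ δ t) : √δ ≤ 1 / 2 :=
  Real.sqrt_le_iff.2 ⟨by norm_num, by linarith [h.delta_le]⟩

theorem one_le_sub_one (h : IsThreshold Q p C₀ δ t) : (1 : ℝ) ≤ (p : ℝ) - 1 := by
  have : (2 : ℝ) ≤ p := by exact_mod_cast h.two_le
  linarith

theorem abs_le_half (h : IsThreshold Q p C₀ δ t) : |t| ≤ 1 / 2 := by
  have h1 : 1 ≤ ((p : ℝ) - 1) * C₀ := one_le_mul_of_one_le_of_one_le h.one_le_sub_one h.one_le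
  nlinarith [h.mul_abs_le, h.sqrt_le, abs_nonneg t]

theorem ratio_sq_le (h : IsThreshold Q p C₀ δ t) :
    (‖Q.top‖ * (√δ)⁻¹) ^ 2 + 2 ≤ Q.thresholdConst p C₀ δ := by
  rw [thresholdConst, mul_pow, inv_pow, Real.sq_sqrt h.delta_pos.le]
  nlinarith [h.one_le, h.one_le_sub_one]

theorem two_le_const (h : IsThreshold Q p C₀ δ t) : 2 ≤ Q.thresholdConst p C₀ δ := by
  nlinarith [h.ratio_sq_le, sq_nonneg (‖Q.top‖ * (√δ)⁻¹)]

theorem ratio_le (h : IsThreshold Q p C₀ δ t) :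
    ‖Q.top‖ * (√δ)⁻¹ ≤ Q.thresholdConst p C₀ δ := by
  nlinarith [h.ratio_sq_le, sq_nonneg (‖Q.top‖ * (√δ)⁻¹ - 1)]

theorem norm_top_sq_le (h : IsThreshold Q p C₀ δ t) :
    ‖Q.top‖ ^ 2 ≤ Q.thresholdConst p C₀ δ := by
  have h1 : ‖Q.top‖ ^ 2 = (‖Q.top‖ * (√δ)⁻¹) ^ 2 * δ := by
    rw [mul_pow, inv_pow, Real.sq_sqrt h.delta_pos.le, inv_mul_cancel_right₀ h.delta_pos.ne']
  nlinarith [h.ratio_sq_le, sq_nonneg (‖Q.top‖ * (√δ)⁻¹), h.delta_le]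

theorem mul_le_const (h : IsThreshold Q p C₀ δ t) :
    ((p : ℝ) - 1) * C₀ ≤ Q.thresholdConst p C₀ δ := by
  have h1 : 0 ≤ ‖Q.top‖ ^ 2 * δ⁻¹ :=
    mul_nonneg (sq_nonneg _) (inv_nonneg.2 h.delta_pos.le)
  rw [thresholdConst]
  nlinarith [h.one_le, h.one_le_sub_one, mul_nonneg (sub_nonneg.2 h.one_le_sub_one)
    (sub_nonneg.2 h.one_le)]

theorem norm_op_sub_le_add (h : IsThreshold Q p C₀ δ t) (u : H) (h₀ : u ∈ (Q.X 0).domain)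
    (h₁ : u ∈ (Q.op p t).domain) :
    ‖Q.op p t ⟨u, h₁⟩ - Q.X 0 ⟨u, h₀⟩‖ ≤
      ((p : ℝ) - 1) * C₀ * |t| * ‖Q.X 0 ⟨u, h₀⟩‖ + |t| / 2 * ‖Q.top‖ * ‖u‖ := by
  have h1 := Q.norm_op_sub_le (by linarith [h.two_le]) h.subordination
    (by linarith [h.abs_le_half]) u h₀ h₁
  have h2 : ‖((t : ℂ) ^ p • Q.top) u‖ ≤ |t| / 2 * ‖Q.top‖ * ‖u‖ := by
    refine (ContinuousLinearMap.le_opNorm _ _).trans ?_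
    rw [norm_smul, norm_pow, Complex.norm_real, Real.norm_eq_abs]
    have h3 : |t| ^ p ≤ |t| / 2 := by
      refine (pow_le_pow_of_le_one (abs_nonneg t) (by linarith [h.abs_le_half]) h.two_le).trans ?_
      nlinarith [h.abs_le_half, abs_nonneg t]
    gcongr
  have h4 := norm_add_le (Q.op p t ⟨u, h₁⟩ - Q.X 0 ⟨u, h₀⟩ - ((t : ℂ) ^ p • Q.top) u)
    (((t : ℂ) ^ p • Q.top) u)
  rw [sub_add_cancel] at h4
  linarith

/-- Subordination bounds the contribution of all lower terms by a multiple of `‖X₀n‖ = 0`. This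
exact cancellation produces the order `t^{2p}` of the effective operator. -/
theorem op_apply_of_mem_N (h : IsThreshold Q p C₀ δ t) (n : H) (hn : n ∈ Q.N) :
    ∃ h : n ∈ (Q.op p t).domain, Q.op p t ⟨n, h⟩ = ((t : ℂ) ^ p • Q.top) n := by
  obtain ⟨h₀, h0⟩ := Q.exists_X_zero_apply_eq_zero hn
  have h₁ : n ∈ (Q.op p t).domain := (h.domain.2 t).symm ▸ h₀
  have h1 := Q.norm_op_sub_le (by linarith [h.two_le]) h.subordination
    (by linarith [h.abs_le_half]) n h₀ h₁
  rw [h0, norm_zero, mul_zero, sub_zero] at h1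
  exact ⟨h₁, sub_eq_zero.1 (norm_le_zero_iff.1 h1)⟩

variable [CompleteSpace K]

theorem isClosed_op (h : IsThreshold Q p C₀ δ t) : (Q.op p t).IsClosed :=
  isClosed_of_relatively_bounded Q.isClosed (h.domain.2 t) ((t : ℂ) ^ p • Q.top)
    (a := ((p : ℝ) - 1) * C₀ * |t|) (by linarith [h.mul_abs_le, h.sqrt_le])
    fun u h₀ h₁ => Q.norm_op_sub_le (by linarith [h.two_le]) h.subordination
      (by linarith [h.abs_le_half]) u h₀ h₁

theorem norm_le (h : IsThreshold Q p C₀ δ t) (x : (Q.X 0).domain) (hx : (x : H) ∈ Q.Nᗮ) :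
    6 * √δ * ‖(x : H)‖ ≤ ‖Q.X 0 x‖ := by
  have h1 := Q.gap_mul_norm_sq_le h.delta_pos h.gap x hx
  refine (pow_le_pow_iff_left₀ (by positivity) (norm_nonneg _) two_ne_zero).1 ?_
  rw [mul_pow, mul_pow, Real.sq_sqrt h.delta_pos.le]
  linarith

theorem norm_op_sub_le_const (h : IsThreshold Q p C₀ δ t) (u : H) (h₀ : u ∈ (Q.X 0).domain)
    (h₁ : u ∈ (Q.op p t).domain) (hu : u ∈ Q.Nᗮ) :
    ‖Q.op p t ⟨u, h₁⟩ - Q.X 0 ⟨u, h₀⟩‖ ≤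
      2 * Q.thresholdConst p C₀ δ * |t| * ‖Q.X 0 ⟨u, h₀⟩‖ := by
  have h1 := h.norm_op_sub_le_add u h₀ h₁
  have h2 := h.norm_le ⟨u, h₀⟩ hu
  have h3 : ‖Q.top‖ * ‖u‖ ≤ Q.thresholdConst p C₀ δ * ‖Q.X 0 ⟨u, h₀⟩‖ := by
    have h4 : ‖Q.top‖ * ‖u‖ = (‖Q.top‖ * (√δ)⁻¹) * (√δ * ‖u‖) := by
      rw [mul_assoc, inv_mul_cancel_left₀ h.sqrt_pos.ne']
    rw [h4]
    refine mul_le_mul h.ratio_le ?_ (by positivity) (by linarith [h.two_le_const])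
    have h5 : 0 ≤ √δ * ‖u‖ := by positivity
    have h6 : 6 * √δ * ‖u‖ ≤ ‖Q.X 0 ⟨u, h₀⟩‖ := h2
    linarith
  have h7 : ((p : ℝ) - 1) * C₀ * (|t| * ‖Q.X 0 ⟨u, h₀⟩‖) ≤
      Q.thresholdConst p C₀ δ * (|t| * ‖Q.X 0 ⟨u, h₀⟩‖) :=
    mul_le_mul_of_nonneg_right h.mul_le_const (by positivity)
  have h8 := mul_le_mul_of_nonneg_left h3 (abs_nonneg t)
  have h9 : 0 ≤ |t| * (Q.thresholdConst p C₀ δ * ‖Q.X 0 ⟨u, h₀⟩‖) := by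
    have := h.two_le_const
    positivity
  linarith

/-- The perturbation takes at most `1/2` of `‖X₀u‖` from the lower terms (as `√δ ≤ 1/2`) and `1/12`
from `X_p` (as `√δ‖u‖ ≤ ‖X₀u‖/6`), so at least `5/12 ≥ 1/3` survives. -/
theorem norm_X_zero_le (h : IsThreshold Q p C₀ δ t) (u : H) (h₀ : u ∈ (Q.X 0).domain)
    (h₁ : u ∈ (Q.op p t).domain) (hu : u ∈ Q.Nᗮ) :
    ‖Q.X 0 ⟨u, h₀⟩‖ ≤ 3 * ‖Q.op p t ⟨u, h₁⟩‖ := by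
  have h1 := h.norm_op_sub_le_add u h₀ h₁
  have h2 : 6 * √δ * ‖u‖ ≤ ‖Q.X 0 ⟨u, h₀⟩‖ := h.norm_le ⟨u, h₀⟩ hu
  have h3 := mul_le_mul_of_nonneg_right h.norm_mul_abs_le (norm_nonneg u)
  have h4 := mul_le_mul_of_nonneg_right (h.mul_abs_le.trans h.sqrt_le)
    (norm_nonneg (Q.X 0 ⟨u, h₀⟩))
  have h5 := norm_le_norm_add_norm_sub (Q.op p t ⟨u, h₁⟩) (Q.X 0 ⟨u, h₀⟩)
  linarith [norm_nonneg (Q.op p t ⟨u, h₁⟩)]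

theorem norm_le_op (h : IsThreshold Q p C₀ δ t) (x : (Q.op p t).domain) (hx : (x : H) ∈ Q.Nᗮ) :
    ‖(x : H)‖ ≤ (√δ)⁻¹ * ‖Q.op p t x‖ := by
  have h₀ : (x : H) ∈ (Q.X 0).domain := h.domain.2 t ▸ x.2
  have h1 : 6 * √δ * ‖(x : H)‖ ≤ ‖Q.X 0 ⟨x, h₀⟩‖ := h.norm_le ⟨x, h₀⟩ hx
  have h2 := h.norm_X_zero_le x h₀ x.2 hx
  have h3 : 0 ≤ √δ * ‖(x : H)‖ := by positivity
  rw [inv_mul_eq_div, le_div_iff₀ h.sqrt_pos]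
  have h4 : ‖Q.X 0 ⟨x, h₀⟩‖ ≤ 3 * ‖Q.op p t x‖ := h2
  linarith

theorem completeSpace_range_zero (h : IsThreshold Q p C₀ δ t) :
    CompleteSpace (restrictedRange (Q.X 0) Q.Nᗮ) := by
  refine completeSpace_restrictedRange Q.isClosed (Submodule.isClosed_orthogonal _)
    (c := (√δ)⁻¹) fun x hx => ?_
  have h1 := h.norm_le x hx
  have h3 : 0 ≤ √δ * ‖(x : H)‖ := by positivity
  rw [inv_mul_eq_div, le_div_iff₀ h.sqrt_pos]
  linarith

theorem completeSpace_range (h : IsThreshold Q p C₀ δ t) :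
    CompleteSpace (restrictedRange (Q.op p t) Q.Nᗮ) :=
  completeSpace_restrictedRange h.isClosed_op (Submodule.isClosed_orthogonal _) h.norm_le_op

theorem norm_projection_sub_le (h : IsThreshold Q p C₀ δ t)
    [(restrictedRange (Q.X 0) Q.Nᗮ).HasOrthogonalProjection]
    [(restrictedRange (Q.op p t) Q.Nᗮ).HasOrthogonalProjection] :
    ‖(restrictedRange (Q.X 0) Q.Nᗮ).starProjection -
      (restrictedRange (Q.op p t) Q.Nᗮ).starProjection‖ ≤
      12 * Q.thresholdConst p C₀ δ * |t| := by
  have hC := h.two_le_const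
  -- The factor `6 = 2 · 3` serves the harder direction, where `‖X₀u‖` must be replaced by
  -- `3‖X(t)u‖`; comparing the projections doubles it to `12`.
  have hη : 0 ≤ 6 * Q.thresholdConst p C₀ δ * |t| := by positivity
  refine (norm_starProjection_sub_le _ _ hη ?_ ?_).trans_eq (by ring)
  · intro y hy
    obtain ⟨x, hx, rfl⟩ := mem_restrictedRange.1 hy
    have h₁ : (x : H) ∈ (Q.op p t).domain := (h.domain.2 t).symm ▸ x.2
    refine ⟨_, mem_restrictedRange.2 ⟨⟨x, h₁⟩, hx, rfl⟩, ?_⟩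
    rw [norm_sub_rev]
    refine (h.norm_op_sub_le_const x x.2 h₁ hx).trans ?_
    refine mul_le_mul_of_nonneg_right ?_ (norm_nonneg _)
    linarith
  · intro y hy
    obtain ⟨x, hx, rfl⟩ := mem_restrictedRange.1 hy
    have h₀ : (x : H) ∈ (Q.X 0).domain := h.domain.2 t ▸ x.2
    refine ⟨_, mem_restrictedRange.2 ⟨⟨x, h₀⟩, hx, rfl⟩, ?_⟩
    refine (h.norm_op_sub_le_const x h₀ x.2 hx).trans ?_
    have h1 := mul_le_mul_of_nonneg_left (h.norm_X_zero_le x h₀ x.2 hx)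
      (show 0 ≤ 2 * Q.thresholdConst p C₀ δ * |t| by positivity)
    exact h1.trans_eq (by ring)

/-- The operator `P X_p* (1 - Π) X_p P`, with `Π` the projection onto `Y`. -/
def compression (Q : Pencil H K) (Y : Submodule ℂ K) [Y.HasOrthogonalProjection] : H →L[ℂ] H :=
  Q.P * (ContinuousLinearMap.adjoint Q.top ∘L (1 - Y.starProjection) ∘L Q.top) * Q.P

theorem norm_compression_sub_le (Q : Pencil H K) (Y Z : Submodule ℂ K)
    [Y.HasOrthogonalProjection] [Z.HasOrthogonalProjection] :
    ‖compression Q Y - compression Q Z‖ ≤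
      ‖Q.top‖ ^ 2 * ‖Z.starProjection - Y.starProjection‖ := by
  have h : compression Q Y - compression Q Z = Q.P * (ContinuousLinearMap.adjoint Q.top ∘L
      (Z.starProjection - Y.starProjection) ∘L Q.top) * Q.P := by
    have h1 : Z.starProjection - Y.starProjection =
        (1 - Y.starProjection) - (1 - Z.starProjection) := by abel
    simp only [h1, compression, ContinuousLinearMap.sub_comp, ContinuousLinearMap.comp_sub,
      mul_sub, sub_mul]
  rw [h]
  have hP : ‖Q.P‖ ≤ 1 := Q.N.starProjection_norm_le
  refine (norm_mul_le _ _).trans ((mul_le_of_le_one_right (norm_nonneg _) hP).trans ?_)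
  refine (norm_mul_le _ _).trans ((mul_le_of_le_one_left (norm_nonneg _) hP).trans ?_)
  refine (ContinuousLinearMap.opNorm_comp_le _ _).trans ?_
  rw [LinearIsometryEquiv.norm_map, pow_two, mul_assoc, mul_comm ‖Q.top‖ ‖_ - _‖]
  exact mul_le_mul_of_nonneg_left (ContinuousLinearMap.opNorm_comp_le _ _) (norm_nonneg _)

theorem norm_SP_le (Q : Pencil H K) : ‖Q.SP‖ ≤ ‖Q.top‖ ^ 2 := by
  have hR : ‖Q.R‖ ≤ ‖Q.top‖ := by
    refine ContinuousLinearMap.opNorm_le_bound _ (norm_nonneg _) fun x => ?_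
    exact (Q.NStar.norm_orthogonalProjectionOnto_apply_le _).trans (Q.top.le_opNorm _)
  refine ContinuousLinearMap.opNorm_le_bound _ (sq_nonneg _) fun x => ?_
  change ‖Q.S (Q.N.orthogonalProjectionOnto x)‖ ≤ _
  refine (Q.S.le_opNorm _).trans ?_
  refine mul_le_mul ?_ (Q.N.norm_orthogonalProjectionOnto_apply_le x) (norm_nonneg _)
    (sq_nonneg _)
  rw [S, ContinuousLinearMap.norm_adjoint_comp_self, pow_two]
  exact mul_le_mul hR hR (norm_nonneg _) (norm_nonneg _)

/-- Existence of an operator close to `P` which nearly intertwines `A(t)` and `t^{2p} S P`. -/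
theorem exists_intertwining (h : IsThreshold Q p C₀ δ t) :
    ∃ L W : H →L[ℂ] H, (∀ x, (L x, W x) ∈ (Q.A p t).graph) ∧
      (∀ x, ‖L x - Q.P x‖ ≤ Q.thresholdConst p C₀ δ * |t| * ‖x‖) ∧
      ‖W - L * ((t : ℂ) ^ (2 * p) • Q.SP)‖ ≤
        13 * Q.thresholdConst p C₀ δ ^ 2 * |t| ^ (2 * p + 1) := by
  have := h.completeSpace_range_zero
  have := h.completeSpace_range
  set C := Q.thresholdConst p C₀ δ
  have hC : 2 ≤ C := h.two_le_const
  set Y₀ := restrictedRange (Q.X 0) Q.Nᗮ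
  set Y := restrictedRange (Q.op p t) Q.Nᗮ
  set F : H →L[ℂ] K := (t : ℂ) ^ p • Q.top
  have hd : Dense ((Q.op p t).domain : Set H) := by rw [h.domain.2 t]; exact Q.dense_domain
  obtain ⟨L, hL⟩ := exists_schur_complement hd Q.N F h.op_apply_of_mem_N
    (inv_nonneg.2 h.sqrt_pos.le) h.norm_le_op
  have hLP : ∀ x, ‖L x - Q.P x‖ ≤ C * |t| * ‖x‖ := by
    intro x
    refine (hL x).2.trans (mul_le_mul_of_nonneg_right ?_ (norm_nonneg x))
    have h1 : ‖F‖ ≤ |t| * ‖Q.top‖ := by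
      rw [norm_smul, norm_pow, Complex.norm_real, Real.norm_eq_abs]
      have := pow_le_of_le_one (abs_nonneg t) (by linarith [h.abs_le_half])
        (show p ≠ 0 by linarith [h.two_le])
      gcongr
    have h2 := mul_le_mul_of_nonneg_left h1 (inv_nonneg.2 h.sqrt_pos.le)
    have h3 := mul_le_mul_of_nonneg_left h.ratio_le (abs_nonneg t)
    linarith
  have hW : Q.N.starProjection * (ContinuousLinearMap.adjoint F ∘L
      (1 - Y.starProjection) ∘L F) * Q.N.starProjection =
      (t : ℂ) ^ (2 * p) • compression Q Y := by
    have hF : ContinuousLinearMap.adjoint F =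
        (t : ℂ) ^ p • ContinuousLinearMap.adjoint Q.top := by
      simp only [F, map_smulₛₗ, map_pow, Complex.conj_ofReal]
    ext x
    simp only [hF, F, compression, P, mul_apply_eq_comp, ContinuousLinearMap.comp_apply,
      smul_apply, map_smul, smul_smul]
    rw [two_mul, pow_add]
  refine ⟨L, _, fun x => (hL x).1, hLP, ?_⟩
  rw [hW]
  have hSP : Q.SP = compression Q Y₀ := Q.SP_eq
  -- Since `P · SP = SP`, the defect splits into the motion of the compression, at most `12C²|t|`,
  -- and `(L - P)SP`, at most `C²|t|`; hence the constant `13`.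
  have hdec : (t : ℂ) ^ (2 * p) • compression Q Y - L * ((t : ℂ) ^ (2 * p) • Q.SP) =
      (t : ℂ) ^ (2 * p) • ((compression Q Y - compression Q Y₀) - (L - Q.P) * Q.SP) := by
    rw [sub_mul, Q.P_mul_SP, ← hSP, mul_smul_comm, ← smul_sub]
    congr 1
    abel
  rw [hdec, norm_smul, norm_pow, Complex.norm_real, Real.norm_eq_abs]
  have h1 : ‖compression Q Y - compression Q Y₀‖ ≤ C * (12 * C * |t|) :=
    (norm_compression_sub_le Q Y Y₀).trans
      (mul_le_mul h.norm_top_sq_le h.norm_projection_sub_le (norm_nonneg _) (by linarith))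
  have h2 : ‖L - Q.P‖ ≤ C * |t| :=
    ContinuousLinearMap.opNorm_le_bound _ (by positivity) hLP
  have h3 : ‖(L - Q.P) * Q.SP‖ ≤ C * |t| * C :=
    (norm_mul_le _ _).trans (mul_le_mul h2 ((norm_SP_le Q).trans h.norm_top_sq_le)
      (norm_nonneg _) (by positivity))
  have h4 := norm_sub_le (compression Q Y - compression Q Y₀) ((L - Q.P) * Q.SP)
  have h5 : ‖(compression Q Y - compression Q Y₀) - (L - Q.P) * Q.SP‖ ≤ 13 * C ^ 2 * |t| := by
    linarith
  refine (mul_le_mul_of_nonneg_left h5 (by positivity)).trans_eq ?_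
  ring

theorem isUnitaryGroup (h : IsThreshold Q p C₀ δ t) :
    IsUnitaryGroup (Q.A p t) (expNegI (Q.A p t)) :=
  Q.isUnitaryGroup_expNegI_A (h.domain.2 t) h.isClosed_op

/-- The threshold approximation of `e^{-i τ A(t)} P`. -/
theorem norm_J_le (h : IsThreshold Q p C₀ δ t) (τ : ℝ) :
    ‖Q.J p t τ‖ ≤ 2 * Q.thresholdConst p C₀ δ * |t| +
      13 * Q.thresholdConst p C₀ δ ^ 2 * |t| ^ (2 * p + 1) * |τ| := by
  obtain ⟨L, W, hLW, hLP, hE⟩ := h.exists_intertwining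
  set C := Q.thresholdConst p C₀ δ
  have hC : 2 ≤ C := h.two_le_const
  refine ContinuousLinearMap.opNorm_le_bound _ (by positivity) fun x => ?_
  have hd : Dense ((Q.op p t).domain : Set H) := by rw [h.domain.2 t]; exact Q.dense_domain
  have hU := h.isUnitaryGroup
  set y := Q.P x
  have hPy : Q.P y = y :=
    Submodule.starProjection_eq_self_iff.2 (Q.N.starProjection_apply_mem x)
  have hy : ‖y‖ ≤ ‖x‖ := Q.N.norm_starProjection_apply_le x
  have hG : IsSelfAdjoint ((t : ℂ) ^ (2 * p) • Q.SP) :=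
    IsSelfAdjoint.smul (by simp [IsSelfAdjoint, ← Complex.ofReal_pow]) Q.isSelfAdjoint_SP
  set e := NormedSpace.exp (τ • (-(Complex.I • ((t : ℂ) ^ (2 * p) • Q.SP)))) y
  have he : ‖e‖ = ‖y‖ := norm_exp_neg_I_smul_apply hG τ y
  have hPe : Q.P e = e := Q.exp_P_apply τ _ x
  have h1 : ‖expNegI (Q.A p t) τ (L y) - L e‖ ≤ 13 * C ^ 2 * |t| ^ (2 * p + 1) * |τ| * ‖y‖ := by
    refine (norm_group_intertwining_le hU (Q.dense_domain_A (h.domain.2 t) h.isClosed_op)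
      (fun _ _ _ _ => inner_symm_of_mem_graph hd) hG hLW τ y).trans ?_
    gcongr
  have h2 : ‖expNegI (Q.A p t) τ (L y - y)‖ ≤ C * |t| * ‖y‖ := by
    rw [hU.norm_apply]
    have := hLP y
    rwa [hPy] at this
  have h3 : ‖L e - e‖ ≤ C * |t| * ‖y‖ := by
    have := hLP e
    rwa [hPe, he] at this
  -- Both `y` and `e` lie in `𝔑`, so `L - P` measures `L y - y` and `L e - e`; these two
  -- replacements give the term `2C|t|`.
  have hdec : Q.J p t τ x = (expNegI (Q.A p t) τ (L y) - L e) -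
      expNegI (Q.A p t) τ (L y - y) + (L e - e) := by
    rw [J_apply, map_sub]
    abel
  have h4 := norm_add_le ((expNegI (Q.A p t) τ (L y) - L e) -
      expNegI (Q.A p t) τ (L y - y)) (L e - e)
  have h5 := norm_sub_le (expNegI (Q.A p t) τ (L y) - L e) (expNegI (Q.A p t) τ (L y - y))
  rw [← hdec] at h4
  have h6 : ‖Q.J p t τ x‖ ≤
      (2 * C * |t| + 13 * C ^ 2 * |t| ^ (2 * p + 1) * |τ|) * ‖y‖ := by
    linarith
  exact h6.trans (mul_le_mul_of_nonneg_left hy (by positivity))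

end IsThreshold

end Pencil

end OperatorPencil

end

/-! ### The main theorem. -/

theorem mainTheorem9 (p : ℕ) (hp : 2 ≤ p) :
    ∃ c₂ c₃ : ℝ, 0 < c₂ ∧ 0 < c₃ ∧
      ∀ (H : Type*) (K : Type*)
        [NormedAddCommGroup H] [InnerProductSpace ℂ H] [CompleteSpace H]
        [TopologicalSpace.SeparableSpace H]
        [NormedAddCommGroup K] [InnerProductSpace ℂ K] [CompleteSpace K]
        [TopologicalSpace.SeparableSpace K]
        (Q : OperatorPencil.Pencil H K) (C₀ δ t₀ : ℝ),
        Q.DomainCondition p →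
        1 ≤ C₀ → Q.SubordinationCondition p C₀ →
        Q.SpectralCondition →
        0 < δ → ENNReal.ofReal δ ≤ Q.gap / 36 → δ ≤ 1 / 4 →
        0 < t₀ → t₀ ≤ √δ * (max (((p : ℝ) - 1) * C₀) ‖Q.top‖)⁻¹ →
        ∀ t : ℝ, |t| ≤ t₀ →
          OperatorPencil.IsUnitaryGroup (Q.A p t) (OperatorPencil.expNegI (Q.A p t)) ∧
          ∀ τ ε : ℝ, 0 < ε →
            ‖Q.J p t (τ * (ε ^ (2 * p))⁻¹)‖ *
                (ε ^ (2 * p + 1) / (t ^ 2 + ε ^ 2) ^ ((p : ℝ) + 1 / 2)) ≤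
              (c₂ * ((p : ℝ) * C₀ ^ 2 + ‖Q.top‖ ^ 2 * δ⁻¹) +
                c₃ * ((p : ℝ) * C₀ ^ 2 + ‖Q.top‖ ^ 2 * δ⁻¹) ^ (2 * p + 1) * |τ|) * ε := by
  refine ⟨2, 13, by norm_num, by norm_num, ?_⟩
  intro H K _ _ _ _ _ _ _ _ Q C₀ δ t₀ hD hC₀ hs hspec hδ hgap hδ4 ht₀ ht₀le t ht
  have hp1 : (1 : ℝ) ≤ (p : ℝ) - 1 := by
    have : (2 : ℝ) ≤ p := by exact_mod_cast hp
    linarith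
  set M := max (((p : ℝ) - 1) * C₀) ‖Q.top‖
  have hM : 0 < M := lt_max_of_lt_left (by positivity)
  have htM : M * |t| ≤ √δ := by
    have h := ht.trans ht₀le
    rw [← div_eq_mul_inv, le_div_iff₀ hM] at h
    linarith
  have hT : OperatorPencil.Pencil.IsThreshold Q p C₀ δ t :=
    { two_le := hp
      domain := hD
      one_le := hC₀
      subordination := hs
      delta_pos := hδ
      delta_le := hδ4
      gap := hgap
      mul_abs_le := (mul_le_mul_of_nonneg_right (le_max_left _ _) (abs_nonneg t)).trans htM
      norm_mul_abs_le := (mul_le_mul_of_nonneg_right (le_max_right _ _) (abs_nonneg t)).trans htM }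
  have hC := hT.two_le_const
  refine ⟨hT.isUnitaryGroup, fun τ ε hε => ?_⟩
  refine OperatorPencil.rescaled_bound_le (t := t) hε
    (b := 2 * Q.thresholdConst p C₀ δ) (c := 13 * Q.thresholdConst p C₀ δ ^ (2 * p + 1))
    (by positivity) (by positivity) ?_
  refine (hT.norm_J_le _).trans ?_
  -- The argument yields `C_T²`; as `C_T ≥ 2`, it is dominated by the required power, so `c₂ = 2`
  -- and `c₃ = 13` serve for every `p`.
  have h : Q.thresholdConst p C₀ δ ^ 2 ≤ Q.thresholdConst p C₀ δ ^ (2 * p + 1) :=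
    pow_le_pow_right₀ (by linarith) (by omega)
  gcongr
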